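/- All graphs are finite, simple and non-empty. A graph is 2-connected if it is connected and has no cut-vertex (so a single vertex and a single edge are 2-connected). A graph $H$ is a minor of $G$ if there are pairwise disjoint, non-empty, connected vertex sets $B_a\subseteq V(G)$, $a\in V(H)$, with an edge of $G$ between $B_a$ and $B_b$ whenever $ab\in E(H)$; $G$ is $H$-minor-free if $H$ is not a minor of $G$. Fix an integer $k\ge 1$. In a connected graph $G$ on $n$ vertices every vertex $v$ has an identifier in $\{1,\dots,n^k\}$, and distinct vertices have distinct identifiers. Each vertex is moreover assigned a certificate, which is a finite string of bits. A verifier is a function that decides, for each vertex, to accept or reject, given only the identifier and certificate of that vertex and the set of pairs (identifier, certificate) of its neighbours. For $f:\mathbb N\to\mathbb N$, a class $\mathcal C$ of connected graphs can be certified with $f(n)$ bits if there is a verifier such that for every $n$, every connected graph $G$ on $n$ vertices and every assignment of identifiers to $G$ as above: (1) if $G\in\mathcal C$, then there is an assignment of certificates of at most $f(n)$ bits for which all vertices accept; (2) if $G\notin\mathcal C$, then for every assignment of certificates, of any length, at least one vertex rejects. Theorem. Let $k\ge 1$ and let $H$ be a 2-connected graph. There is a constant $C$, depending only on $k$ and $H$,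 such that for every non-decreasing $f:\mathbb N\to\mathbb N$: if the class of 2-connected $H$-minor-free graphs can be certified with $f(n)$ bits, then the class of connected $H$-minor-free graphs can be certified with $C\cdot(f(n)+\lfloor\log_2 n\rfloor)$ bits, that is, with $O(f(n)+\log n)$ bits. -/

import Mathlib

namespace LocalCert

/-- `H` is a minor of `G`, through a model of `H` in `G`: pairwise disjoint (nonempty) connected
branch sets, one for each vertex of `H`, with an edge of `G` between the branch sets of any two
adjacent vertices of `H`. -/
def IsMinor {W : Type*} {V : Type*} (H : SimpleGraph W) (G : SimpleGraph V) : Prop :=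
  ∃ B : W → Set V,
    (∀ a, (G.induce (B a)).Connected) ∧
    (∀ a b, a ≠ b → Disjoint (B a) (B b)) ∧
    (∀ a b, H.Adj a b → ∃ x ∈ B a, ∃ y ∈ B b, G.Adj x y)

/-- `G` is `H`-minor-free. -/
def MinorFree {W : Type*} {V : Type*} (H : SimpleGraph W) (G : SimpleGraph V) : Prop :=
  ¬ IsMinor H G

/-- A graph is 2-connected if it is connected and has no cut-vertex. The one-vertex graph and the
single edge count as 2-connected (a block of a graph may be a bridge). -/
def TwoConnected {V : Type*} (G : SimpleGraph V) : Prop :=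
  G.Connected ∧ ∀ v : V, (G.induce {v}ᶜ).Preconnected

/-- A certificate is a string of bits. -/
abbrev Certificate : Type := List Bool

/-- A verifier at distance 1: it reads the identifier and the certificate of a node, and the
identifiers and certificates of its neighbors, and outputs `true` (accept) or `false` (reject). -/
abbrev Verifier : Type := ℕ × Certificate → Finset (ℕ × Certificate) → Bool

/-- Unique identifiers in the range `[1, n ^ k]`, where `n` is the number of nodes. -/
def ValidIds {V : Type} [Fintype V] (k : ℕ) (ids : V → ℕ) : Prop :=
  Function.Injective ids ∧ ∀ v, 1 ≤ ids v ∧ ids v ≤ Fintype.card V ^ k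

open Classical in
/-- What a node `v` collects from its neighbors: their identifiers and certificates. -/
noncomputable def neighborView {V : Type} [Fintype V] (G : SimpleGraph V) (ids : V → ℕ)
    (c : V → Certificate) (v : V) : Finset (ℕ × Certificate) :=
  (Finset.univ.filter (fun u => G.Adj v u)).image (fun u => (ids u, c u))

/-- The verifier accepts the certificate assignment `c`: every node outputs accept. -/
def Accepts (A : Verifier) {V : Type} [Fintype V] (G : SimpleGraph V) (ids : V → ℕ)
    (c : V → Certificate) : Prop :=
  ∀ v, A (ids v, c v) (neighborView G ids c v) = true

/-- The class `P` of (connected, finite) graphs can be certified with `f n`-bit certificates when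
identifiers are taken in `[1, n ^ k]`: there is one verifier such that, for every connected graph
`G` on `n` nodes and all identifiers in that range,
* if `G` is in `P`, some assignment of certificates of at most `f n` bits is accepted;
* if `G` is not in `P`, no assignment of certificates, of any size, is accepted. -/
def CertifiableWith (k : ℕ) (f : ℕ → ℕ) (P : ∀ {V : Type}, SimpleGraph V → Prop) : Prop :=
  ∃ A : Verifier, ∀ (V : Type) [Fintype V] (G : SimpleGraph V), G.Connected →
    ∀ ids : V → ℕ, ValidIds k ids →
      (P G → ∃ c : V → Certificate,
        (∀ v, (c v).length ≤ f (Fintype.card V)) ∧ Accepts A G ids c) ∧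
      (¬ P G → ∀ c : V → Certificate, ¬ Accepts A G ids c)

end LocalCert

/-!
A connected graph is glued from its blocks at cut vertices, and a 2-connected `H` with at least two
vertices is a minor of `G` only if it is a minor of one of the blocks: a cut vertex lies in at most
one branch set of a model of `H`, and as `H` minus that branch vertex is connected, all other branch
sets lie on the same side of it. It therefore suffices to certify every block with the given
verifier `A`.

Peeling off leaf blocks partitions the vertices: the part of a block consists of its vertices except
the cut vertex, called its root, by which it hangs on blocks peeled off later. The certificate of a
vertex holds the rank of its part in this order, the root of the part with its certificate in the
block, a number of the vertex in a depth-first numbering of a spanning tree of the part, and its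
own certificate in the block. The numbers have two purposes. They serve as identifiers in the block
(those of `G` may be too large for its size), and the intervals of descendants make it possible to
check locally that the part is connected and numbered from `2` on without gaps, while the root gets
the number `1`. A vertex can then simulate `A` on all blocks that contain it. Soundness does not
need the parts to come from the actual blocks: the ranks force them to form a tree glued at single
vertices, which is enough to split a model of `H`.
-/

namespace LocalCert

open SimpleGraph

section Separation

variable {V V' W : Type*} {G : SimpleGraph V} {H : SimpleGraph W} {S X Y : Set V} {r : V}

theorem reachable_of_adj_reachable {G' : SimpleGraph V'} (f : V → V')
    (h : ∀ u v, G.Adj u v → G'.Reachable (f u) (f v)) {u v : V} (huv : G.Reachable u v) :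
    G'.Reachable (f u) (f v) := by
  obtain ⟨p⟩ := huv
  induction p with
  | nil => exact Reachable.refl _
  | cons hadj _ ih => exact (h _ _ hadj).trans ih

theorem reachable_induction {p : V → Prop} (h : ∀ u v, G.Adj u v → p u → p v) {u v : V}
    (huv : G.Reachable u v) (hu : p u) : p v := by
  obtain ⟨w⟩ := huv
  induction w with
  | nil => exact hu
  | cons hadj _ ih => exact ih (h _ _ hadj hu)

theorem connected_induce_image {B : Set S} (h : ((G.induce S).induce B).Connected) :
    (G.induce (Subtype.val '' B)).Connected := by
  let f : (G.induce S).induce B →g G.induce (Subtype.val '' B) :=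
    ⟨fun x => ⟨x.1.1, x.1, x.2, rfl⟩, id⟩
  refine h.map f ?_
  rintro ⟨_, x, hx, rfl⟩
  exact ⟨⟨x, hx⟩, rfl⟩

theorem connected_induce_preimage {B : Set V} (hBS : B ⊆ S) (h : (G.induce B).Connected) :
    ((G.induce S).induce (Subtype.val ⁻¹' B)).Connected := by
  let f : G.induce B →g (G.induce S).induce (Subtype.val ⁻¹' B) :=
    ⟨fun x => ⟨⟨x.1, hBS x.2⟩, x.2⟩, id⟩
  exact h.map f fun x => ⟨⟨x.1.1, x.2⟩, rfl⟩

/-- `X` and `Y` are the sides of a separation of order one of `G.induce (X ∪ Y)`: they share only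
the vertex `r`, and every edge between them is incident with `r`. -/
structure OneSeparation (G : SimpleGraph V) (X Y : Set V) (r : V) : Prop where
  inter_eq : X ∩ Y = {r}
  eq_or_eq_of_adj : ∀ x ∈ X, ∀ y ∈ Y, G.Adj x y → x = r ∨ y = r

namespace OneSeparation

theorem symm (h : OneSeparation G X Y r) : OneSeparation G Y X r where
  inter_eq := Set.inter_comm X Y ▸ h.inter_eq
  eq_or_eq_of_adj x hx y hy hxy := (h.eq_or_eq_of_adj y hy x hx hxy.symm).symm

theorem of_insert_sdiff {P : Set V} (hr : r ∈ S \ P)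
    (h : ∀ x ∈ P, ∀ y ∈ S \ P, G.Adj x y → y = r) : OneSeparation G (insert r P) (S \ P) r where
  inter_eq := by rw [Set.insert_inter_of_mem hr, Set.inter_sdiff_self, insert_empty_eq]
  eq_or_eq_of_adj x hx y hy hxy := hx.imp id fun hxP => h x hxP y hy hxy

theorem mem_left (h : OneSeparation G X Y r) : r ∈ X :=
  (h.inter_eq.ge rfl).1

theorem eq_of_mem (h : OneSeparation G X Y r) {u : V} (hX : u ∈ X) (hY : u ∈ Y) : u = r :=
  h.inter_eq.le ⟨hX, hY⟩

theorem same_side_of_adj (h : OneSeparation G X Y r) {x y : V} (hx : x ∈ X ∪ Y) (hy : y ∈ X ∪ Y)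
    (hxy : G.Adj x y) : (x ∈ X ∧ y ∈ X) ∨ (x ∈ Y ∧ y ∈ Y) := by
  have hrX := h.mem_left
  have hrY := h.symm.mem_left
  rcases hx with hx | hx <;> rcases hy with hy | hy
  · exact Or.inl ⟨hx, hy⟩
  · rcases h.eq_or_eq_of_adj x hx y hy hxy with rfl | rfl
    · exact Or.inr ⟨hrY, hy⟩
    · exact Or.inl ⟨hx, hrX⟩
  · rcases h.eq_or_eq_of_adj y hy x hx hxy.symm with rfl | rfl
    · exact Or.inr ⟨hx, hrY⟩
    · exact Or.inl ⟨hrX, hy⟩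
  · exact Or.inr ⟨hx, hy⟩

/-- Sending the other side to the separator is a retraction. -/
theorem connected_inter (h : OneSeparation G X Y r) {C : Set V} (hC : (G.induce C).Connected)
    (hCXY : C ⊆ X ∪ Y) (hr : r ∈ C) : (G.induce (C ∩ X)).Connected := by
  classical
  let f : C → ↥(C ∩ X) := fun u => if hu : u.1 ∈ X then ⟨u.1, u.2, hu⟩ else ⟨r, hr, h.mem_left⟩
  have f_left (u : C) (hu : u.1 ∈ X) : f u = ⟨u.1, u.2, hu⟩ := dif_pos hu
  have f_right (u : C) (hu : u.1 ∈ Y) : f u = ⟨r, hr, h.mem_left⟩ := by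
    by_cases hX : u.1 ∈ X
    · exact (f_left u hX).trans (Subtype.ext (h.eq_of_mem hX hu))
    · exact dif_neg hX
  have reachable_of_adj (u v : C) (huv : (G.induce C).Adj u v) :
      (G.induce (C ∩ X)).Reachable (f u) (f v) := by
    rcases h.same_side_of_adj (hCXY u.2) (hCXY v.2) huv with ⟨hu, hv⟩ | ⟨hu, hv⟩
    · rw [f_left u hu, f_left v hv]
      exact Adj.reachable (by exact huv)
    · rw [f_right u hu, f_right v hv]
  have : Nonempty ↥(C ∩ X) := ⟨r, hr, h.mem_left⟩
  refine ⟨fun u v => ?_⟩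
  have huv := reachable_of_adj_reachable f reachable_of_adj
    (hC.preconnected ⟨u.1, u.2.1⟩ ⟨v.1, v.2.1⟩)
  rwa [f_left _ u.2.2, f_left _ v.2.2] at huv

theorem connected_left (h : OneSeparation G X Y r) (hC : (G.induce (X ∪ Y)).Connected) :
    (G.induce X).Connected := by
  have := h.connected_inter hC subset_rfl (Or.inl h.mem_left)
  rwa [Set.union_inter_cancel_left] at this

theorem subset_or_subset (h : OneSeparation G X Y r) {C : Set V} (hC : (G.induce C).Connected)
    (hCXY : C ⊆ X ∪ Y) (hr : r ∉ C) : C ⊆ X ∨ C ⊆ Y := by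
  by_cases hCX : ∃ x ∈ C, x ∈ X
  · obtain ⟨x, hxC, hxX⟩ := hCX
    refine Or.inl fun y hy => ?_
    refine reachable_induction (p := fun u : C => u.1 ∈ X) (fun u v huv hu => ?_)
      (hC.preconnected ⟨x, hxC⟩ ⟨y, hy⟩) hxX
    rcases h.same_side_of_adj (hCXY u.2) (hCXY v.2) huv with ⟨_, hv⟩ | ⟨hu', _⟩
    · exact hv
    · exact absurd (h.eq_of_mem hu hu' ▸ u.2) hr
  · exact Or.inr fun y hy => (hCXY hy).resolve_left fun hyX => hCX ⟨y, hy, hyX⟩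

end OneSeparation

/-- `H` has a model in `G` all of whose branch sets lie inside `S`. Unlike `IsMinor H (G.induce S)`,
to which it is equivalent, it does not change the vertex type, so that `S` can vary. -/
def MinorIn (H : SimpleGraph W) (G : SimpleGraph V) (S : Set V) : Prop :=
  ∃ B : W → Set V, (∀ a, B a ⊆ S) ∧
    (∀ a, (G.induce (B a)).Connected) ∧
    (∀ a b, a ≠ b → Disjoint (B a) (B b)) ∧
    (∀ a b, H.Adj a b → ∃ x ∈ B a, ∃ y ∈ B b, G.Adj x y)

theorem MinorIn.mono {T : Set V} (h : MinorIn H G S) (hST : S ⊆ T) : MinorIn H G T := by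
  obtain ⟨B, hB, hmodel⟩ := h
  exact ⟨B, fun a => (hB a).trans hST, hmodel⟩

theorem minorIn_univ_iff : MinorIn H G Set.univ ↔ IsMinor H G :=
  ⟨fun ⟨B, _, hmodel⟩ => ⟨B, hmodel⟩, fun ⟨B, hmodel⟩ => ⟨B, fun _ => Set.subset_univ _, hmodel⟩⟩

theorem isMinor_induce_iff : IsMinor H (G.induce S) ↔ MinorIn H G S := by
  constructor
  · rintro ⟨B, hconn, hdisj, hadj⟩
    refine ⟨fun a => Subtype.val '' B a, fun a => Subtype.coe_image_subset S (B a),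
      fun a => connected_induce_image (hconn a),
      fun a b hab => (Set.disjoint_image_iff Subtype.val_injective).2 (hdisj a b hab),
      fun a b hab => ?_⟩
    obtain ⟨x, hx, y, hy, hxy⟩ := hadj a b hab
    exact ⟨x, ⟨x, hx, rfl⟩, y, ⟨y, hy, rfl⟩, hxy⟩
  · rintro ⟨B, hBS, hconn, hdisj, hadj⟩
    refine ⟨fun a => Subtype.val ⁻¹' B a, fun a => connected_induce_preimage (hBS a) (hconn a),
      fun a b hab => (hdisj a b hab).preimage _, fun a b hab => ?_⟩
    obtain ⟨x, hx, y, hy, hxy⟩ := hadj a b hab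
    exact ⟨⟨x, hBS a hx⟩, hx, ⟨y, hBS b hy⟩, hy, hxy⟩

theorem not_minorFree_of_subsingleton [Subsingleton W] (hG : G.Connected) : ¬ MinorFree H G :=
  not_not_intro ⟨fun _ => Set.univ, fun _ => (induceUnivIso G).connected_iff.2 hG,
    fun a b hab => absurd (Subsingleton.elim a b) hab,
    fun a b hab => absurd (Subsingleton.elim a b) hab.ne⟩

theorem MinorFree.induce (h : MinorFree H G) (S : Set V) : MinorFree H (G.induce S) := fun hS =>
  h (minorIn_univ_iff.1 ((isMinor_induce_iff.1 hS).mono (Set.subset_univ S)))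

namespace OneSeparation

variable {B : W → Set V}

theorem minorIn_left (h : OneSeparation G X Y r) (hBXY : ∀ a, B a ⊆ X ∪ Y)
    (hconn : ∀ a, (G.induce (B a)).Connected) (hdisj : ∀ a b, a ≠ b → Disjoint (B a) (B b))
    (hadj : ∀ a b, H.Adj a b → ∃ x ∈ B a, ∃ y ∈ B b, G.Adj x y)
    (hX : ∀ a, r ∉ B a → B a ⊆ X) : MinorIn H G X := by
  have hconnX (a : W) : (G.induce (B a ∩ X)).Connected := by
    by_cases hr : r ∈ B a
    · exact h.connected_inter (hconn a) (hBXY a) hr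
    · rw [Set.inter_eq_left.2 (hX a hr)]
      exact hconn a
  refine ⟨fun a => B a ∩ X, fun a => Set.inter_subset_right, hconnX, fun a b hab =>
    (hdisj a b hab).mono Set.inter_subset_left Set.inter_subset_left, fun a b hab => ?_⟩
  obtain ⟨x, hx, y, hy, hxy⟩ := hadj a b hab
  have separator_mem {c : W} {z : V} (hz : z ∈ B c) (hzY : z ∈ Y) : r ∈ B c :=
    by_contra fun hr => hr (h.eq_of_mem (hX c hr hz) hzY ▸ hz)
  rcases h.same_side_of_adj (hBXY a hx) (hBXY b hy) hxy with ⟨hxX, hyX⟩ | ⟨hxY, hyY⟩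
  · exact ⟨x, ⟨hx, hxX⟩, y, ⟨hy, hyX⟩, hxy⟩
  · exact absurd (separator_mem hy hyY)
      (Set.disjoint_left.1 (hdisj a b hab.ne) (separator_mem hx hxY))

theorem subset_left_of_adj (h : OneSeparation G X Y r) (hBXY : ∀ a, B a ⊆ X ∪ Y)
    (hconn : ∀ a, (G.induce (B a)).Connected) {a b : W}
    (hadj : ∃ x ∈ B a, ∃ y ∈ B b, G.Adj x y) (hra : r ∉ B a) (hrb : r ∉ B b) (ha : B a ⊆ X) :
    B b ⊆ X := by
  refine (h.subset_or_subset (hconn b) (hBXY b) hrb).resolve_right fun hb => ?_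
  obtain ⟨x, hx, y, hy, hxy⟩ := hadj
  rcases h.eq_or_eq_of_adj x (ha hx) y (hb hy) hxy with rfl | rfl
  · exact hra hx
  · exact hrb hy

/-- At most one branch set contains `r`, and the others are linked through a connected subgraph of
`H`, as `H` has no cut vertex. -/
theorem subset_left_of_twoConnected (h : OneSeparation G X Y r) (hH : TwoConnected H)
    (hBXY : ∀ a, B a ⊆ X ∪ Y) (hconn : ∀ a, (G.induce (B a)).Connected)
    (hdisj : ∀ a b, a ≠ b → Disjoint (B a) (B b))
    (hadj : ∀ a b, H.Adj a b → ∃ x ∈ B a, ∃ y ∈ B b, G.Adj x y)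
    {a b : W} (hra : r ∉ B a) (hrb : r ∉ B b) (ha : B a ⊆ X) : B b ⊆ X := by
  by_cases hr : ∃ c, r ∈ B c
  · obtain ⟨c, hc⟩ := hr
    have not_mem (d : W) (hd : d ≠ c) : r ∉ B d := Set.disjoint_left.1 (hdisj c d hd.symm) hc
    exact reachable_induction (G := H.induce {c}ᶜ) (p := fun d => B d.1 ⊆ X)
      (fun u v huv => h.subset_left_of_adj hBXY hconn (hadj _ _ huv) (not_mem u u.2)
        (not_mem v v.2))
      (hH.2 c ⟨a, fun hac => hra (hac ▸ hc)⟩ ⟨b, fun hbc => hrb (hbc ▸ hc)⟩) ha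
  · have not_mem (d : W) : r ∉ B d := fun hd => hr ⟨d, hd⟩
    exact reachable_induction (p := fun d => B d ⊆ X)
      (fun u v huv => h.subset_left_of_adj hBXY hconn (hadj u v huv) (not_mem u) (not_mem v))
      (hH.1.preconnected a b) ha

theorem minorIn_or_minorIn (h : OneSeparation G X Y r) (hH : TwoConnected H)
    (hmin : MinorIn H G (X ∪ Y)) : MinorIn H G X ∨ MinorIn H G Y := by
  obtain ⟨B, hBXY, hconn, hdisj, hadj⟩ := hmin
  by_cases hX : ∃ a, r ∉ B a ∧ B a ⊆ X
  · obtain ⟨a, hra, ha⟩ := hX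
    exact Or.inl <| h.minorIn_left hBXY hconn hdisj hadj fun b hrb =>
      h.subset_left_of_twoConnected hH hBXY hconn hdisj hadj hra hrb ha
  · refine Or.inr <| h.symm.minorIn_left (fun a => Set.union_comm X Y ▸ hBXY a) hconn hdisj hadj
      fun b hrb => (h.subset_or_subset (hconn b) (hBXY b) hrb).resolve_left fun hb =>
        hX ⟨b, hrb, hb⟩

end OneSeparation

end Separation

section TreeOfParts

variable {V W L : Type*} {G : SimpleGraph V} {H : SimpleGraph W} {label : V → L} {root : L → V}
  {rank : L → ℕ}

/-- The vertices of `G` are partitioned by `label`, and each part of nonzero rank is glued to parts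
of smaller rank along the single vertex `root`. The vertices with a label of rank zero are glued to
nothing (in a connected graph there is only one of them). -/
structure TreeOfParts (G : SimpleGraph V) (label : V → L) (root : L → V) (rank : L → ℕ) :
    Prop where
  rank_root_lt : ∀ u, rank (label u) ≠ 0 → rank (label (root (label u))) < rank (label u)
  of_adj : ∀ u w, G.Adj u w → (rank (label w) ≠ 0 ∧ root (label w) = u) ∨
    rank (label u) ≠ 0 ∧ (root (label u) = w ∨ label w = label u)

namespace TreeOfParts

theorem oneSeparation (h : TreeOfParts G label root rank) {S : Set V}
    (hroot : ∀ v ∈ S, rank (label v) ≠ 0 → root (label v) ∈ S) {u : V} (hu : u ∈ S)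
    (hrank : rank (label u) ≠ 0) (hmax : ∀ v ∈ S, rank (label v) ≤ rank (label u)) :
    OneSeparation G (insert (root (label u)) {w | label w = label u}) (S \ {w | label w = label u})
      (root (label u)) := by
  refine .of_insert_sdiff ⟨hroot u hu hrank, fun heq => ?_⟩ fun x hx y ⟨hyS, hyP⟩ hxy => ?_
  · exact (h.rank_root_lt u hrank).ne (congrArg rank heq)
  · rcases h.of_adj x y hxy with ⟨hy, rfl⟩ | ⟨-, hy | hy⟩
    · have := h.rank_root_lt y hy
      rw [show label (root (label y)) = label u from hx] at this
      exact absurd (hmax y hyS) this.not_ge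
    · exact hx ▸ hy.symm
    · exact absurd (hy.trans hx) hyP

/-- A part of maximal rank hangs on the rest by its root, so it can be peeled off. -/
theorem not_minorIn [Finite V] [Nontrivial W] (h : TreeOfParts G label root rank)
    (hH : TwoConnected H)
    (hpart : ∀ u, rank (label u) ≠ 0 →
      ¬ MinorIn H G (insert (root (label u)) {w | label w = label u}))
    (S : Set V) (hroot : ∀ v ∈ S, rank (label v) ≠ 0 → root (label v) ∈ S) :
    ¬ MinorIn H G S := by
  induction S using WellFoundedLT.induction with
  | ind S ih =>
  intro hmin
  by_cases hS : ∃ u ∈ S, rank (label u) ≠ 0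
  · obtain ⟨u₀, hu₀, hrank₀⟩ := hS
    obtain ⟨u, huS, hmax⟩ := S.exists_max_image (rank ∘ label) S.toFinite ⟨u₀, hu₀⟩
    have hrank : rank (label u) ≠ 0 := fun h0 =>
      hrank₀ (Nat.le_zero.1 (h0 ▸ hmax u₀ hu₀))
    have cover : S ⊆ insert (root (label u)) {w | label w = label u} ∪
        (S \ {w | label w = label u}) := by
      rw [Set.insert_union, Set.union_sdiff_self]
      exact Set.subset_union_right.trans (Set.subset_insert _ _)
    rcases (h.oneSeparation hroot huS hrank hmax).minorIn_or_minorIn hH (hmin.mono cover)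
      with hP | hrest
    · exact hpart u hrank hP
    · have smaller : S \ {w | label w = label u} < S :=
        ⟨Set.sdiff_subset, fun hsub => (hsub huS).2 rfl⟩
      refine ih _ smaller (fun v hv hvrank => ?_) hrest
      refine ⟨hroot v hv.1 hvrank, fun hvP => ?_⟩
      have := h.rank_root_lt v hvrank
      rw [show label (root (label v)) = label u from hvP] at this
      exact absurd (hmax v hv.1) this.not_ge
  · obtain ⟨B, hBS, -, -, hadj⟩ := hmin
    obtain ⟨a⟩ := hH.1.nonempty
    obtain ⟨b, hab⟩ := hH.1.preconnected.exists_adj_of_nontrivial a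
    obtain ⟨x, hx, y, hy, hxy⟩ := hadj a b hab
    rcases h.of_adj x y hxy with ⟨hrank, -⟩ | ⟨hrank, -⟩
    · exact hS ⟨y, hBS b hy, hrank⟩
    · exact hS ⟨x, hBS a hx, hrank⟩

theorem minorFree [Finite V] [Nontrivial W] (h : TreeOfParts G label root rank)
    (hH : TwoConnected H)
    (hpart : ∀ u, rank (label u) ≠ 0 →
      ¬ MinorIn H G (insert (root (label u)) {w | label w = label u})) : MinorFree H G :=
  fun hmin => h.not_minorIn hH hpart Set.univ (fun _ _ _ => Set.mem_univ _)
    (minorIn_univ_iff.2 hmin)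

end TreeOfParts

end TreeOfParts

section LeafBlock

variable {V : Type*} {G : SimpleGraph V} {S P : Set V} {r v ρ : V}

theorem twoConnected_induce_iff : TwoConnected (G.induce S) ↔
    (G.induce S).Connected ∧ ∀ v ∈ S, (G.induce (S \ {v})).Preconnected := by
  have compl_iff (v : S) : ((G.induce S).induce {v}ᶜ).Preconnected ↔
      (G.induce (S \ {v.1})).Preconnected := by
    let e : (G.induce S).induce {v}ᶜ ≃g G.induce (S \ {v.1}) :=
      { toFun := fun x => ⟨x.1, x.1.2, fun h => x.2 (Subtype.ext h)⟩
        invFun := fun x => ⟨⟨x.1, x.2.1⟩, fun h => x.2.2 (congrArg Subtype.val h)⟩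
        map_rel_iff' := Iff.rfl }
    exact e.preconnected_iff
  simp only [TwoConnected, compl_iff, Subtype.forall]

theorem exists_connected_oneSeparation (hv : v ∈ S) {q : V} (hq : q ∈ S \ {v}) :
    ∃ K ⊆ S \ {v}, q ∈ K ∧ (G.induce K).Connected ∧ OneSeparation G (insert v K) (S \ K) v := by
  let c := (G.induce (S \ {v})).connectedComponentMk ⟨q, hq⟩
  have hKS : Subtype.val '' c.supp ⊆ S \ {v} := Subtype.coe_image_subset _ _
  have hvK : v ∉ Subtype.val '' c.supp := fun h => (hKS h).2 rfl
  refine ⟨Subtype.val '' c.supp, hKS, ⟨⟨q, hq⟩, rfl, rfl⟩,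
    connected_induce_image c.connected_toSimpleGraph, .of_insert_sdiff ⟨hv, hvK⟩ ?_⟩
  rintro _ ⟨x, hx, rfl⟩ y ⟨hyS, hyK⟩ hxy
  exact by_contra fun hyv => hyK
    ⟨⟨y, hyS, hyv⟩, c.mem_supp_of_adj_mem_supp hx (by exact hxy), rfl⟩

theorem exists_oneSeparation_of_not_twoConnected (hS : (G.induce S).Connected)
    (h : ¬ TwoConnected (G.induce S)) (r : V) :
    ∃ v ∈ S, ∃ K ⊆ S \ {v}, K.Nonempty ∧ r ∉ K ∧ (S \ insert v K).Nonempty ∧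
      OneSeparation G (insert v K) (S \ K) v := by
  obtain ⟨v, hv, x, y, hxy⟩ :
      ∃ v ∈ S, ∃ x y, ¬ (G.induce (S \ {v})).Reachable x y := by
    by_contra! hreach
    exact h (twoConnected_induce_iff.2 ⟨hS, hreach⟩)
  have reachable_of_mem {K : Set V} (hKS : K ⊆ S \ {v}) (hK : (G.induce K).Connected) {a b : V}
      (ha : a ∈ K) (hb : b ∈ K) : (G.induce (S \ {v})).Reachable ⟨a, hKS ha⟩ ⟨b, hKS hb⟩ :=
    (hK.preconnected ⟨a, ha⟩ ⟨b, hb⟩).map (G.induceHomOfLE hKS).toHom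
  obtain ⟨K, hKS, hxK, hK, hKsep⟩ := exists_connected_oneSeparation (G := G) hv x.2
  have hyK : y.1 ∉ K := fun hyK => hxy (reachable_of_mem hKS hK hxK hyK)
  by_cases hrK : r ∈ K
  · obtain ⟨K', hKS', hyK', hK', hKsep'⟩ := exists_connected_oneSeparation (G := G) hv y.2
    have disjoint {z : V} (hz : z ∈ K) (hz' : z ∈ K') : False :=
      hxy ((reachable_of_mem hKS hK hxK hz).trans (reachable_of_mem hKS' hK' hz' hyK'))
    refine ⟨v, hv, K', hKS', ⟨y, hyK'⟩, disjoint hrK, ⟨x, x.2.1, ?_⟩, hKsep'⟩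
    rintro (hxv | hxK')
    · exact x.2.2 hxv
    · exact disjoint hxK hxK'
  · refine ⟨v, hv, K, hKS, ⟨x, hxK⟩, hrK, ⟨y, y.2.1, ?_⟩, hKsep⟩
    rintro (hyv | hyK')
    · exact y.2.2 hyv
    · exact hyK hyK'

/-- `insert ρ P` is a leaf block of `G.induce S`, hanging on the rest by its vertex `ρ`; as opposed
to the usual notion, a 2-connected `G.induce S` counts as a leaf block, with any choice of `ρ`. -/
structure IsLeafBlock (G : SimpleGraph V) (S P : Set V) (ρ : V) : Prop where
  subset : P ⊆ S
  nonempty : P.Nonempty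
  oneSeparation : OneSeparation G (insert ρ P) (S \ P) ρ
  twoConnected : TwoConnected (G.induce (insert ρ P))

namespace IsLeafBlock

theorem root_mem (h : IsLeafBlock G S P ρ) : ρ ∈ S \ P :=
  h.oneSeparation.symm.mem_left

theorem mem_insert_of_adj (h : IsLeafBlock G S P ρ) {u w : V} (hu : u ∈ P) (hw : w ∈ S)
    (huw : G.Adj u w) : w ∈ insert ρ P := by
  by_contra hwP
  rcases h.oneSeparation.eq_or_eq_of_adj u (Set.mem_insert_of_mem ρ hu) w
    ⟨hw, fun hw' => hwP (Set.mem_insert_of_mem ρ hw')⟩ huw with rfl | rfl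
  · exact h.root_mem.2 hu
  · exact hwP (Set.mem_insert w P)

theorem connected_part (h : IsLeafBlock G S P ρ) : (G.induce P).Connected := by
  have := h.nonempty.to_subtype
  have hP := (twoConnected_induce_iff.1 h.twoConnected).2 ρ (Set.mem_insert ρ P)
  rw [Set.insert_sdiff_self_of_notMem h.root_mem.2] at hP
  exact ⟨hP⟩

theorem exists_adj_root (h : IsLeafBlock G S P ρ) : ∃ l ∈ P, G.Adj l ρ := by
  obtain ⟨q, hq⟩ := h.nonempty
  have : Nontrivial ↥(insert ρ P) := ⟨⟨⟨q, Set.mem_insert_of_mem ρ hq⟩, ⟨ρ, Set.mem_insert ρ P⟩,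
    fun heq => ne_of_mem_of_not_mem hq h.root_mem.2 (congrArg Subtype.val heq)⟩⟩
  obtain ⟨⟨l, hl⟩, hlρ⟩ :=
    h.twoConnected.1.preconnected.exists_adj_of_nontrivial ⟨ρ, Set.mem_insert ρ P⟩
  exact ⟨l, hl.resolve_left fun heq => hlρ.ne (Subtype.ext heq.symm), hlρ.symm⟩

theorem connected_sdiff (h : IsLeafBlock G S P ρ) (hS : (G.induce S).Connected) :
    (G.induce (S \ P)).Connected := by
  refine h.oneSeparation.symm.connected_left ?_
  rwa [Set.union_insert, Set.sdiff_union_of_subset h.subset, Set.insert_eq_of_mem h.root_mem.1]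

theorem of_oneSeparation {K : Set V} (h : IsLeafBlock G (insert v K) P ρ)
    (hK : OneSeparation G (insert v K) (S \ K) v) (hKS : K ⊆ S) (hvP : v ∉ P) :
    IsLeafBlock G S P ρ := by
  have hvS : v ∈ S := hK.symm.mem_left.1
  have hPK : P ⊆ K := fun x hx => (h.subset hx).resolve_left fun hxv => hvP (hxv ▸ hx)
  have hρ : ρ ∈ S \ P := ⟨Set.insert_subset hvS hKS h.root_mem.1, h.root_mem.2⟩
  refine ⟨hPK.trans hKS, h.nonempty, .of_insert_sdiff hρ fun x hx y ⟨hyS, hyP⟩ hxy => ?_,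
    h.twoConnected⟩
  have hxρ : x ≠ ρ := fun hxρ => h.root_mem.2 (hxρ ▸ hx)
  have hxv : x ≠ v := fun hxv => hvP (hxv ▸ hx)
  by_cases hyK : y ∈ insert v K
  · exact (h.oneSeparation.eq_or_eq_of_adj x (Or.inr hx) y ⟨hyK, hyP⟩ hxy).resolve_left hxρ
  · have := hK.eq_or_eq_of_adj x (Or.inr (hPK hx)) y ⟨hyS, fun hy => hyK (Or.inr hy)⟩ hxy
    exact absurd (Or.inl (this.resolve_left hxv)) hyK

end IsLeafBlock

theorem isLeafBlock_of_twoConnected (hS : TwoConnected (G.induce S)) (hr : r ∈ S)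
    (hne : S.Nontrivial) : IsLeafBlock G S (S \ {r}) r where
  subset := Set.sdiff_subset
  nonempty := hne.exists_ne r
  oneSeparation := .of_insert_sdiff ⟨hr, fun h => h.2 rfl⟩ fun _ _ _ ⟨hyS, hy⟩ _ =>
    by_contra fun hyr => hy ⟨hyS, hyr⟩
  twoConnected := by rwa [Set.insert_sdiff_self_of_mem hr]

theorem exists_isLeafBlock [Finite V] (hS : (G.induce S).Connected) (hr : r ∈ S)
    (hne : S.Nontrivial) : ∃ P ρ, IsLeafBlock G S P ρ ∧ r ∉ P := by
  induction S using WellFoundedLT.induction generalizing r with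
  | ind S ih =>
  by_cases h2 : TwoConnected (G.induce S)
  · exact ⟨S \ {r}, r, isLeafBlock_of_twoConnected h2 hr hne, fun h => h.2 rfl⟩
  · obtain ⟨v, hv, K, hKS, ⟨q, hq⟩, hrK, ⟨z, hzS, hzK⟩, hsep⟩ :=
      exists_oneSeparation_of_not_twoConnected hS h2 r
    have hKS' : K ⊆ S := hKS.trans Set.sdiff_subset
    have smaller : insert v K < S := ⟨Set.insert_subset hv hKS', fun hsub => hzK (hsub hzS)⟩
    have hK : (G.induce (insert v K)).Connected := by
      refine hsep.connected_left ?_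
      rwa [Set.insert_union, Set.union_sdiff_cancel hKS', Set.insert_eq_of_mem hv]
    obtain ⟨P, ρ, hP, hvP⟩ := ih _ smaller hK (Set.mem_insert v K)
      ⟨q, Or.inr hq, v, Or.inl rfl, (hKS hq).2⟩
    exact ⟨P, ρ, hP.of_oneSeparation hsep hKS' hvP, fun hrP =>
      (hP.subset hrP).elim (fun hrv => hvP (hrv ▸ hrP)) hrK⟩

theorem leafBlock_induction [Finite V] {p : Set V → Prop} (singleton : p {r})
    (attach : ∀ S P ρ, IsLeafBlock G S P ρ → r ∈ S \ P → p (S \ P) → p S)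
    (hS : (G.induce S).Connected) (hr : r ∈ S) : p S := by
  induction S using WellFoundedLT.induction with
  | ind S ih =>
  rcases Set.eq_singleton_or_nontrivial hr with rfl | hne
  · exact singleton
  · obtain ⟨P, ρ, hP, hrP⟩ := exists_isLeafBlock hS hr hne
    obtain ⟨q, hq⟩ := hP.nonempty
    have smaller : S \ P < S := ⟨Set.sdiff_subset, fun hsub => (hsub (hP.subset hq)).2 hq⟩
    exact attach S P ρ hP ⟨hr, hrP⟩ (ih _ smaller (hP.connected_sdiff hS) ⟨hr, hrP⟩)

end LeafBlock

section IntervalNumbering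

variable {V : Type*} {G : SimpleGraph V} {P : Set V} {l : V} {s : ℕ}

/-- A spanning tree of `G.induce P` rooted at `l`, numbered from `s` on in depth-first order: `par`
is the parent function, `lo u` is the number of `u`, and `Set.Ico (lo u) (hi u)` contains the
numbers of the descendants of `u`. All conditions involve only a vertex, its parent and its
children, so that they can be checked locally. -/
structure IntervalNumbering (G : SimpleGraph V) (P : Set V) (l : V) (s : ℕ) where
  par : V → V
  lo : V → ℕ
  hi : V → ℕ
  root_mem : l ∈ P
  lo_root : lo l = s
  lo_lt_hi : ∀ u ∈ P, lo u < hi u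
  par_mem : ∀ u ∈ P, u ≠ l → par u ∈ P
  adj_par : ∀ u ∈ P, u ≠ l → G.Adj u (par u)
  lo_par_lt : ∀ u ∈ P, u ≠ l → lo (par u) < lo u
  hi_le_hi_par : ∀ u ∈ P, u ≠ l → hi u ≤ hi (par u)
  existsUnique_child : ∀ u ∈ P, ∀ x ∈ Set.Ioo (lo u) (hi u),
    ∃! w, (w ∈ P ∧ w ≠ l ∧ par w = u) ∧ x ∈ Set.Ico (lo w) (hi w)

namespace IntervalNumbering

theorem par_induction (N : IntervalNumbering G P l s) {p : V → Prop} (root : p l)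
    (par : ∀ u ∈ P, u ≠ l → p (N.par u) → p u) : ∀ u ∈ P, p u := by
  intro u
  induction u using (measure N.lo).wf.induction with
  | _ u ih =>
  intro hu
  by_cases hul : u = l
  · exact hul ▸ root
  · exact par u hu hul (ih _ (N.lo_par_lt u hu hul) (N.par_mem u hu hul))

theorem connected (N : IntervalNumbering G P l s) : (G.induce P).Connected := by
  have reachable_root : ∀ u ∈ P, ∀ hu : u ∈ P,
      (G.induce P).Reachable ⟨u, hu⟩ ⟨l, N.root_mem⟩ := by
    refine N.par_induction (fun _ => Reachable.refl _) fun u hu hul ih _ => ?_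
    have hadj : (G.induce P).Adj ⟨u, hu⟩ ⟨N.par u, N.par_mem u hu hul⟩ := N.adj_par u hu hul
    exact hadj.reachable.trans (ih _)
  exact connected_iff_exists_forall_reachable _ |>.2
    ⟨⟨l, N.root_mem⟩, fun u => (reachable_root u u.2 u.2).symm⟩

theorem start_le_lo (N : IntervalNumbering G P l s) : ∀ u ∈ P, s ≤ N.lo u :=
  N.par_induction N.lo_root.ge fun u hu hul ih => ih.trans (N.lo_par_lt u hu hul).le

theorem hi_le_hi_root (N : IntervalNumbering G P l s) : ∀ u ∈ P, N.hi u ≤ N.hi l :=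
  N.par_induction le_rfl fun u hu hul ih => (N.hi_le_hi_par u hu hul).trans ih

theorem exists_lo_eq (N : IntervalNumbering G P l s) {u : V} (hu : u ∈ P) {x : ℕ}
    (hx : x ∈ Set.Ico (N.lo u) (N.hi u)) : ∃ w ∈ P, N.lo w = x := by
  induction hd : x - N.lo u using Nat.strong_induction_on generalizing u with
  | _ d ih =>
  rcases hx.1.eq_or_lt with hxu | hxu
  · exact ⟨u, hu, hxu⟩
  · obtain ⟨w, ⟨⟨hw, hwl, rfl⟩, hxw⟩, -⟩ := N.existsUnique_child u hu x ⟨hxu, hx.2⟩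
    have := N.lo_par_lt w hw hwl
    exact ih (x - N.lo w) (by have := hxw.1; omega) hw hxw rfl

theorem hi_root_le [Finite V] (N : IntervalNumbering G P l s) : N.hi l ≤ s + P.ncard := by
  have hsub : Set.Ico s (N.hi l) ⊆ N.lo '' P := fun x hx =>
    N.exists_lo_eq N.root_mem (N.lo_root.symm ▸ hx)
  have hcard := (Set.ncard_le_ncard hsub).trans (Set.ncard_image_le P.toFinite)
  rw [← Finset.coe_Ico, Set.ncard_coe_finset, Nat.card_Ico] at hcard
  omega

theorem hi_le [Finite V] (N : IntervalNumbering G P l s) {u : V} (hu : u ∈ P) :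
    N.hi u ≤ s + P.ncard :=
  (N.hi_le_hi_root u hu).trans N.hi_root_le

/-- `w` is a descendant of `v` in the spanning tree. -/
def Descendant (N : IntervalNumbering G P l s) : V → V → Prop :=
  Relation.ReflTransGen fun u w => w ∈ P ∧ w ≠ l ∧ N.par w = u

theorem descendant_root (N : IntervalNumbering G P l s) : ∀ u ∈ P, N.Descendant l u :=
  N.par_induction .refl fun _ hu hul ih => ih.tail ⟨hu, hul, rfl⟩

theorem Descendant.interval_subset {N : IntervalNumbering G P l s} {v w : V}
    (h : N.Descendant v w) : Set.Ico (N.lo w) (N.hi w) ⊆ Set.Ico (N.lo v) (N.hi v) := by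
  induction h with
  | refl => rfl
  | tail _ hchild ih =>
    obtain ⟨hw, hwl, rfl⟩ := hchild
    exact (Set.Ico_subset_Ico (N.lo_par_lt _ hw hwl).le (N.hi_le_hi_par _ hw hwl)).trans ih

theorem descendant_of_lo_mem (N : IntervalNumbering G P l s) {w : V} (hw : w ∈ P) :
    ∀ v ∈ P, N.lo w ∈ Set.Ico (N.lo v) (N.hi v) → N.Descendant v w := by
  refine N.par_induction (fun _ => N.descendant_root w hw) fun v hv hvl ih hwv => ?_
  have hlo := N.lo_par_lt v hv hvl
  have hpar : N.lo w ∈ Set.Ioo (N.lo (N.par v)) (N.hi (N.par v)) :=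
    ⟨hlo.trans_le hwv.1, hwv.2.trans_le (N.hi_le_hi_par v hv hvl)⟩
  rcases (ih (Set.Ioo_subset_Ico_self hpar)).cases_head with heq | ⟨c, hc, hcw⟩
  · exact absurd (congrArg N.lo heq) hpar.1.ne
  · have hwc : N.lo w ∈ Set.Ico (N.lo c) (N.hi c) :=
      Descendant.interval_subset hcw ⟨le_rfl, N.lo_lt_hi w hw⟩
    have hcv : c = v := (N.existsUnique_child _ (N.par_mem v hv hvl) _ hpar).unique
      ⟨hc, hwc⟩ ⟨⟨hv, hvl, rfl⟩, hwv⟩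
    exact hcv ▸ hcw

theorem lo_injOn (N : IntervalNumbering G P l s) : Set.InjOn N.lo P := by
  intro u hu w hw heq
  have huw : N.Descendant u w := N.descendant_of_lo_mem hw u hu ⟨heq.le, heq ▸ N.lo_lt_hi u hu⟩
  rcases huw.cases_head with rfl | ⟨c, ⟨hc, hcl, rfl⟩, hcw⟩
  · rfl
  · have hwc := (Descendant.interval_subset hcw ⟨le_rfl, N.lo_lt_hi w hw⟩).1
    exact absurd heq ((N.lo_par_lt c hc hcl).trans_le hwc).ne

/-- The numbering of a single vertex. -/
def single (G : SimpleGraph V) (l : V) (s : ℕ) : IntervalNumbering G {l} l s where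
  par := id
  lo _ := s
  hi _ := s + 1
  root_mem := rfl
  lo_root := rfl
  lo_lt_hi _ _ := Nat.lt_succ_self s
  par_mem _ hu _ := hu
  adj_par _ hu hul := absurd hu hul
  lo_par_lt _ hu hul := absurd hu hul
  hi_le_hi_par _ _ _ := le_rfl
  existsUnique_child _ _ _ hx := absurd hx.2 (Nat.not_lt.2 hx.1)

section glue

variable {A K : Set V} {q : V}

open Classical in
/-- Two numbered trees are joined by making the root `q` of the second one the last child of the
root `l` of the first one. -/
noncomputable def glue (N₁ : IntervalNumbering G A l s) (N₂ : IntervalNumbering G K q (N₁.hi l))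
    (hAK : Disjoint A K) (hlq : G.Adj q l) : IntervalNumbering G (A ∪ K) l s where
  par u := if u = q then l else if u ∈ K then N₂.par u else N₁.par u
  lo u := if u ∈ K then N₂.lo u else N₁.lo u
  hi u := if u ∈ K then N₂.hi u else if u = l then N₂.hi q else N₁.hi u
  root_mem := Or.inl N₁.root_mem
  lo_root := by grind [N₁.root_mem, N₁.lo_root]
  lo_lt_hi := by
    have hlt₁ := N₁.lo_lt_hi
    have hlt₂ := N₂.lo_lt_hi
    grind [N₂.lo_root, N₂.root_mem]
  par_mem := by grind [N₁.root_mem, N₁.par_mem, N₂.par_mem]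
  adj_par := by grind [N₁.adj_par, N₂.adj_par]
  lo_par_lt := by
    have hlq : N₁.lo l < N₂.lo q := N₂.lo_root.symm ▸ N₁.lo_lt_hi l N₁.root_mem
    have hpar₁ := N₁.lo_par_lt
    have hpar₂ := N₂.lo_par_lt
    grind [N₁.root_mem, N₂.root_mem, N₁.par_mem, N₂.par_mem]
  hi_le_hi_par := by
    have hlq : N₁.hi l < N₂.hi q := N₂.lo_root.symm.trans_lt (N₂.lo_lt_hi q N₂.root_mem)
    have hpar₁ := N₁.hi_le_hi_par
    have hpar₂ := N₂.hi_le_hi_par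
    grind [N₁.root_mem, N₂.root_mem, N₁.par_mem, N₂.par_mem]
  existsUnique_child := by
    have hl := N₁.root_mem
    have hq := N₂.root_mem
    have hloq := N₂.lo_root
    have hdisj := Set.disjoint_left.1 hAK
    rintro u (hu | hu) x hx
    · by_cases hnew : u = l ∧ N₁.hi l ≤ x
      · refine ⟨q, by grind, fun w hw => ?_⟩
        have hhi := N₁.hi_le_hi_root w
        grind [N₂.par_mem]
      · have hx₁ : x ∈ Set.Ioo (N₁.lo u) (N₁.hi u) := by grind
        refine (existsUnique_congr fun w => ?_).1 (N₁.existsUnique_child u hu x hx₁)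
        grind [N₂.par_mem]
    · have hx₂ : x ∈ Set.Ioo (N₂.lo u) (N₂.hi u) := by grind
      refine (existsUnique_congr fun w => ?_).1 (N₂.existsUnique_child u hu x hx₂)
      grind [N₁.par_mem]

end glue

theorem nonempty_of_connected [Finite V] (hP : (G.induce P).Connected) (hl : l ∈ P) (s : ℕ) :
    Nonempty (IntervalNumbering G P l s) := by
  induction P using WellFoundedLT.induction generalizing l s with
  | ind P ih =>
  rcases Set.eq_singleton_or_nontrivial hl with rfl | hne
  · exact ⟨single G l s⟩
  · have := hne.coe_sort
    obtain ⟨⟨q, hq⟩, hlq⟩ := hP.preconnected.exists_adj_of_nontrivial ⟨l, hl⟩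
    obtain ⟨K, hKP, hqK, hK, hsep⟩ :=
      exists_connected_oneSeparation (G := G) hl ⟨hq, fun h => hlq.ne (Subtype.ext h.symm)⟩
    have hKP' : K ⊆ P := hKP.trans Set.sdiff_subset
    have hrest : (G.induce (P \ K)).Connected := by
      refine hsep.symm.connected_left ?_
      rwa [Set.union_insert, Set.sdiff_union_of_subset hKP', Set.insert_eq_of_mem hl]
    have hlK : l ∉ K := fun h => (hKP h).2 rfl
    obtain ⟨N₁⟩ := ih (P \ K) ⟨Set.sdiff_subset, fun hsub => (hsub hq).2 hqK⟩ hrest ⟨hl, hlK⟩ s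
    obtain ⟨N₂⟩ := ih K ⟨hKP', fun hsub => hlK (hsub hl)⟩ hK hqK (N₁.hi l)
    rw [← Set.sdiff_union_of_subset hKP']
    exact ⟨N₁.glue N₂ Set.disjoint_sdiff_left hlq.symm⟩

end IntervalNumbering

end IntervalNumbering

section Encoding

/-- The description of a part of the vertex set on which the verifier for blocks is simulated: its
rank in the decomposition, the identifier of the root of its spanning tree, and the identifier of
the vertex outside along which it is glued, with the certificate of that vertex in this block. The
vertex in no part gets a label of rank zero. -/
structure PartLabel where
  rank : ℕ
  lead : ℕ
  root : ℕ
  rootCert : Certificate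

/-- The content of a certificate: the label of the part of a vertex, the identifier of its parent
and its interval in the numbering of the part, and its certificate in the block. -/
structure VertexRecord where
  part : PartLabel
  par : ℕ
  lo : ℕ
  hi : ℕ
  cert : Certificate

instance : Inhabited VertexRecord := ⟨⟨⟨0, 0, 0, []⟩, 0, 0, 0, []⟩⟩

/-- A self-delimiting encoding of a pair of bit strings: the first string with a `true` in front of
each bit, then `false`, then the second string. -/
def pack : List Bool → List Bool → List Bool
  | [], t => false :: t
  | x :: s, t => true :: x :: pack s t

theorem pack_injective2 : Function.Injective2 pack := by
  intro s s' t t' h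
  induction s generalizing s' with
  | nil => cases s' <;> simp_all [pack]
  | cons x s ih =>
    cases s' with
    | nil => simp [pack] at h
    | cons x' s' =>
      simp only [pack, List.cons.injEq, true_and] at h
      obtain ⟨hs, ht⟩ := ih h.2
      exact ⟨by rw [h.1, hs], ht⟩

theorem length_pack (s t : List Bool) : (pack s t).length = 2 * s.length + 1 + t.length := by
  induction s with
  | nil => simp [pack, Nat.add_comm]
  | cons x s ih => simp only [pack, List.length_cons, ih]; omega

theorem bits_injective : Function.Injective Nat.bits := by
  intro m n h
  have hdigits := congrArg (List.map fun b : Bool => cond b 1 0) h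
  rwa [← Nat.digits_two_eq_bits, ← Nat.digits_two_eq_bits, Nat.digits_inj_iff] at hdigits

theorem size_pow_add_one_le {k : ℕ} (hk : k ≠ 0) (n : ℕ) :
    Nat.size (n ^ k + 1) ≤ k * (Nat.log 2 n + 1) + 1 := by
  have hpow : n ^ k < 2 ^ (k * (Nat.log 2 n + 1)) := by
    rw [Nat.mul_comm, pow_mul]
    exact Nat.pow_lt_pow_left (Nat.lt_pow_succ_log_self one_lt_two n) hk
  rw [Nat.size_le, pow_succ]
  omega

namespace VertexRecord

/-- All the fields of a record, one after the other. -/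
def encodeFields (R : VertexRecord) : Certificate :=
  pack R.part.rank.bits <| pack R.part.lead.bits <| pack R.part.root.bits <| pack R.par.bits <|
    pack R.lo.bits <| pack R.hi.bits <| pack R.cert R.part.rootCert

theorem encodeFields_injective : Function.Injective encodeFields := by
  rintro ⟨⟨rank, lead, root, rootCert⟩, par, lo, hi, cert⟩
    ⟨⟨rank', lead', root', rootCert'⟩, par', lo', hi', cert'⟩ h
  obtain ⟨hrank, h⟩ := pack_injective2 h
  obtain ⟨hlead, h⟩ := pack_injective2 h
  obtain ⟨hroot, h⟩ := pack_injective2 h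
  obtain ⟨hpar, h⟩ := pack_injective2 h
  obtain ⟨hlo, h⟩ := pack_injective2 h
  obtain ⟨hhi, h⟩ := pack_injective2 h
  obtain ⟨hcert, hrootCert⟩ := pack_injective2 h
  simp only [mk.injEq, PartLabel.mk.injEq]
  exact ⟨⟨bits_injective hrank, bits_injective hlead, bits_injective hroot, hrootCert⟩,
    bits_injective hpar, bits_injective hlo, bits_injective hhi, hcert⟩

open Classical in
/-- The bit string that stores a record. The default record has an empty encoding, because a graph
with a single vertex must be certified with zero bits when `f 1 = 0`. -/
noncomputable def encode (R : VertexRecord) : Certificate :=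
  if R = default then [] else R.encodeFields

theorem encode_default : encode default = [] :=
  if_pos rfl

theorem encode_injective : Function.Injective encode := by
  have ne_nil (R : VertexRecord) : R.encodeFields ≠ [] := by
    rw [← List.length_pos_iff, encodeFields, length_pack]
    omega
  intro R R' h
  by_cases hR : R = default <;> by_cases hR' : R' = default
  · rw [hR, hR']
  · rw [encode, encode, if_pos hR, if_neg hR'] at h
    exact absurd h.symm (ne_nil R')
  · rw [encode, encode, if_neg hR, if_pos hR'] at h
    exact absurd h (ne_nil R)
  · rw [encode, encode, if_neg hR, if_neg hR'] at h
    exact encodeFields_injective h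

/-- The record stored in a bit string. -/
noncomputable def decode : Certificate → VertexRecord :=
  Function.invFun encode

theorem decode_encode (R : VertexRecord) : decode R.encode = R :=
  Function.leftInverse_invFun encode_injective R

/-- The numbers in the record are at most `m`, and its certificates have length at most `b`. -/
structure Bounded (R : VertexRecord) (m b : ℕ) : Prop where
  rank_le : R.part.rank ≤ m
  lead_le : R.part.lead ≤ m
  root_le : R.part.root ≤ m
  par_le : R.par ≤ m
  lo_le : R.lo ≤ m
  hi_le : R.hi ≤ m
  length_cert_le : R.cert.length ≤ b
  length_rootCert_le : R.part.rootCert.length ≤ b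

variable {R : VertexRecord} {m b : ℕ}

theorem bounded_default (m b : ℕ) : Bounded default m b := by
  constructor <;> exact Nat.zero_le _

theorem Bounded.length_encode_le (h : R.Bounded m b) :
    R.encode.length ≤ 12 * Nat.size m + 3 * b + 7 := by
  by_cases hR : R = default
  · rw [hR, encode_default]
    exact Nat.zero_le _
  · have hrank := Nat.size_le_size h.rank_le
    have hlead := Nat.size_le_size h.lead_le
    have hroot := Nat.size_le_size h.root_le
    have hpar := Nat.size_le_size h.par_le
    have hlo := Nat.size_le_size h.lo_le
    have hhi := Nat.size_le_size h.hi_le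
    have hcert := h.length_cert_le
    have hrootCert := h.length_rootCert_le
    simp only [encode, if_neg hR, encodeFields, length_pack, Nat.size_eq_bits_len]
    omega

theorem Bounded.length_encode_le_log {k n : ℕ} (hk : k ≠ 0) (hn : 2 ≤ n)
    (h : R.Bounded (n ^ k + 1) b) : R.encode.length ≤ (24 * k + 19) * (b + Nat.log 2 n) := by
  have hlog : 1 ≤ Nat.log 2 n := Nat.log_pos one_lt_two hn
  have hsize := size_pow_add_one_le hk n
  calc R.encode.length ≤ 12 * (k * (Nat.log 2 n + 1) + 1) + 3 * b + 7 := by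
        have := h.length_encode_le
        omega
    _ ≤ (24 * k + 19) * (b + Nat.log 2 n) := by nlinarith

end VertexRecord

end Encoding

section BlockIds

variable {V : Type*} {G : SimpleGraph V} {P : Set V} {l r u : V}

namespace IntervalNumbering

open Classical in
/-- The identifiers of the vertices of the block `insert r P` in the simulation of the verifier:
those of `P` are numbered from `2` on, and `r` gets the number `1`. -/
noncomputable def blockIds (N : IntervalNumbering G P l 2) (r u : V) : ℕ :=
  if u = r then 1 else N.lo u

theorem blockIds_root (N : IntervalNumbering G P l 2) (r : V) : N.blockIds r r = 1 :=
  if_pos rfl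

theorem blockIds_of_ne (N : IntervalNumbering G P l 2) (hu : u ≠ r) :
    N.blockIds r u = N.lo u :=
  if_neg hu

theorem validIds_blockIds {V : Type} [Finite V] {G : SimpleGraph V} {P : Set V} {l r : V}
    (N : IntervalNumbering G P l 2) [Fintype ↥(insert r P)] (hr : r ∉ P) {k : ℕ} (hk : 1 ≤ k) :
    ValidIds k fun x : ↥(insert r P) => N.blockIds r x := by
  have hcard : Fintype.card ↥(insert r P) = P.ncard + 1 := by
    rw [← Nat.card_eq_fintype_card, Nat.card_coe_set_eq, Set.ncard_insert_of_notMem hr]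
  have hlo : ∀ x ∈ P, N.blockIds r x = N.lo x := fun x hx =>
    N.blockIds_of_ne (ne_of_mem_of_not_mem hx hr)
  have hroot := N.blockIds_root r
  have hstart := N.start_le_lo
  refine ⟨?_, ?_⟩
  · rintro ⟨x, hx⟩ ⟨y, hy⟩ (hxy : N.blockIds r x = N.blockIds r y)
    rcases hx with rfl | hx <;> rcases hy with rfl | hy
    · rfl
    · grind
    · grind
    · exact Subtype.ext (N.lo_injOn hx hy (hlo x hx ▸ hlo y hy ▸ hxy))
  · rintro ⟨x, hx⟩
    rw [hcard]
    suffices 1 ≤ N.blockIds r x ∧ N.blockIds r x ≤ P.ncard + 1 from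
      this.imp_right fun h => h.trans (Nat.le_self_pow (Nat.one_le_iff_ne_zero.1 hk) _)
    rcases hx with rfl | hx
    · omega
    · have := N.lo_lt_hi x hx
      have := N.hi_le hx
      have := hstart x hx
      have := hlo x hx
      omega

end IntervalNumbering

end BlockIds

section LocalCheck

/-- A vertex, given by its identifier and its record, belongs to the block with label `L`: it lies
in the part labelled `L` or is the vertex along which this part is glued. -/
def InBlock (L : PartLabel) (p : ℕ × VertexRecord) : Prop :=
  p.1 = L.root ∨ p.2.part = L

/-- The identifier and the certificate of a vertex in the simulation of the verifier on the block
with label `L`: the vertex outside the part has number `1`. -/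
def entry (L : PartLabel) (p : ℕ × VertexRecord) : ℕ × Certificate :=
  if p.1 = L.root then (1, L.rootCert) else (p.2.lo, p.2.cert)

open Classical in
/-- What a vertex of the block with label `L` collects from its neighbors in the simulation of the
verifier on this block. -/
noncomputable def blockView (L : PartLabel) (N : Finset (ℕ × VertexRecord)) :
    Finset (ℕ × Certificate) :=
  (N.filter (InBlock L)).image (entry L)

/-- The test, at a vertex with identifier `i` and record `R` and neighbors `N`, that the part of
the vertex carries an interval numbering from `2` on and hangs on a part of smaller rank. -/
structure NumberingCheck (i : ℕ) (R : VertexRecord) (N : Finset (ℕ × VertexRecord)) : Prop where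
  lead : i = R.part.lead → R.lo = 2 ∧ ∃ p ∈ N, p.1 = R.part.root ∧ p.2.part.rank < R.part.rank
  parent : i ≠ R.part.lead →
    ∃ p ∈ N, p.2.part = R.part ∧ p.1 = R.par ∧ p.2.lo < R.lo ∧ R.hi ≤ p.2.hi
  lo_lt_hi : R.lo < R.hi
  children : ∀ x ∈ Set.Ioo R.lo R.hi, ∃! p : ℕ × VertexRecord,
    (p ∈ N ∧ p.2.part = R.part ∧ p.1 ≠ R.part.lead ∧ p.2.par = i) ∧ x ∈ Set.Ico p.2.lo p.2.hi

/-- The test, at a vertex with identifier `i` and record `R` and neighbors `N`, that every edge lies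
in a block, that the part of the vertex is correctly numbered, and that the verifier `A` accepts in
the simulation on each block of the vertex. -/
structure LocalCheck (A : Verifier) (i : ℕ) (R : VertexRecord) (N : Finset (ℕ × VertexRecord)) :
    Prop where
  edge : ∀ p ∈ N, (p.2.part.rank ≠ 0 ∧ p.2.part.root = i) ∨
    (R.part.rank ≠ 0 ∧ InBlock R.part p)
  numbering : R.part.rank ≠ 0 → NumberingCheck i R N
  simulate : ∀ p, p = (i, R) ∨ p ∈ N → p.2.part.rank ≠ 0 → InBlock p.2.part (i, R) →
    A (entry p.2.part (i, R)) (blockView p.2.part N) = true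

variable {V : Type} [Fintype V] {G : SimpleGraph V} {S : Set V} {ids : V → ℕ}
  {D : V → VertexRecord} {v : V}

open Classical in
/-- The identifiers and records of the neighbors of `v` in `S`. -/
noncomputable def recordView (G : SimpleGraph V) (S : Set V) (ids : V → ℕ)
    (D : V → VertexRecord) (v : V) : Finset (ℕ × VertexRecord) :=
  (Finset.univ.filter fun u => G.Adj v u ∧ u ∈ S).image fun u => (ids u, D u)

theorem mem_recordView {p : ℕ × VertexRecord} :
    p ∈ recordView G S ids D v ↔ ∃ u, (G.Adj v u ∧ u ∈ S) ∧ (ids u, D u) = p := by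
  simp only [recordView, Finset.mem_image, Finset.mem_filter_univ]

theorem forall_mem_recordView {q : ℕ × VertexRecord → Prop} :
    (∀ p ∈ recordView G S ids D v, q p) ↔ ∀ u, G.Adj v u → u ∈ S → q (ids u, D u) := by
  simp only [mem_recordView]
  grind

open Classical in
theorem recordView_univ (c : V → Certificate) :
    recordView G Set.univ ids (fun u => VertexRecord.decode (c u)) v =
      (neighborView G ids c v).image fun p => (p.1, VertexRecord.decode p.2) := by
  simp only [recordView, neighborView, Finset.image_image, Function.comp_def, Set.mem_univ,
    and_true]

theorem neighborView_induce_entry {L : PartLabel} {B : Set V} [Fintype ↥B]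
    (hB : ∀ x, x ∈ B ↔ x ∈ S ∧ InBlock L (ids x, D x)) (v : ↥B) :
    neighborView (G.induce B) (fun x => (entry L (ids x, D x)).1)
      (fun x => (entry L (ids x, D x)).2) v = blockView L (recordView G S ids D v) := by
  ext p
  simp only [neighborView, blockView, Finset.mem_image, Finset.mem_filter, Finset.mem_univ,
    true_and, mem_recordView, comap_adj, Function.Embedding.subtype_apply]
  constructor
  · rintro ⟨x, hx, rfl⟩
    exact ⟨_, ⟨⟨x, ⟨hx, ((hB x).1 x.2).1⟩, rfl⟩, ((hB x).1 x.2).2⟩, rfl⟩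
  · rintro ⟨_, ⟨⟨x, ⟨hx, hxS⟩, rfl⟩, hxL⟩, rfl⟩
    exact ⟨⟨x, (hB x).2 ⟨hxS, hxL⟩⟩, hx, rfl⟩

end LocalCheck

section Soundness

variable {V : Type} [Fintype V] {G : SimpleGraph V} {A : Verifier} {ids : V → ℕ}
  {vertex : ℕ → V} {D : V → VertexRecord} {L : PartLabel} {u l r : V}

theorem exists_adj_par (hids : Function.LeftInverse vertex ids)
    (h : NumberingCheck (ids u) (D u) (recordView G Set.univ ids D u))
    (hu : ids u ≠ (D u).part.lead) :
    (D (vertex (D u).par)).part = (D u).part ∧ ids (vertex (D u).par) = (D u).par ∧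
      G.Adj u (vertex (D u).par) ∧ (D (vertex (D u).par)).lo < (D u).lo ∧
      (D u).hi ≤ (D (vertex (D u).par)).hi := by
  obtain ⟨p, hp, hpart, hpar, hlo, hhi⟩ := h.parent hu
  obtain ⟨w, ⟨hadj, -⟩, rfl⟩ := mem_recordView.1 hp
  rw [← show ids w = (D u).par from hpar, hids w]
  exact ⟨hpart, rfl, hadj, hlo, hhi⟩

theorem exists_lead (hids : Function.LeftInverse vertex ids)
    (h : ∀ v, (D v).part = L → NumberingCheck (ids v) (D v) (recordView G Set.univ ids D v))
    (hu : (D u).part = L) :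
    ∃ l, (D l).part = L ∧ ids l = L.lead ∧ G.Adj l (vertex L.root) ∧
      ids (vertex L.root) = L.root ∧ (D (vertex L.root)).part.rank < L.rank := by
  induction u using (measure fun v => (D v).lo).wf.induction with
  | _ u ih =>
  by_cases hlead : ids u = L.lead
  · obtain ⟨-, p, hp, hroot, hrank⟩ := (h u hu).lead (hu ▸ hlead)
    obtain ⟨r, ⟨hadj, -⟩, rfl⟩ := mem_recordView.1 hp
    rw [hu] at hroot hrank
    rw [← show ids r = L.root from hroot, hids r]
    exact ⟨u, hu, hlead, hadj, rfl, hrank⟩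
  · obtain ⟨hpart, -, -, hlo, -⟩ := exists_adj_par hids (h u hu) (hu ▸ hlead)
    exact ih _ hlo (hpart.trans hu)

theorem exists_intervalNumbering (hids : Function.LeftInverse vertex ids)
    (h : ∀ v, (D v).part = L → NumberingCheck (ids v) (D v) (recordView G Set.univ ids D v))
    (hl : (D l).part = L) (hlead : ids l = L.lead) :
    ∃ N : IntervalNumbering G {v | (D v).part = L} l 2, ∀ v, N.lo v = (D v).lo := by
  have hpar (u : V) (hu : (D u).part = L) (hul : u ≠ l) :=
    exists_adj_par hids (h u hu) fun heq => hul (hids.injective (heq.trans (hu ▸ hlead.symm)))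
  refine ⟨{
    par u := vertex (D u).par
    lo u := (D u).lo
    hi u := (D u).hi
    root_mem := hl
    lo_root := ((h l hl).lead (hl ▸ hlead)).1
    lo_lt_hi u hu := (h u hu).lo_lt_hi
    par_mem u hu hul := (hpar u hu hul).1.trans hu
    adj_par u hu hul := (hpar u hu hul).2.2.1
    lo_par_lt u hu hul := (hpar u hu hul).2.2.2.1
    hi_le_hi_par u hu hul := (hpar u hu hul).2.2.2.2
    existsUnique_child u hu x hx := ?_ }, fun _ => rfl⟩
  obtain ⟨p, ⟨⟨hp, hpart, hplead, hpu⟩, hxp⟩, huniq⟩ := (h u hu).children x hx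
  obtain ⟨w, -, rfl⟩ := mem_recordView.1 hp
  have hwl : w ≠ l := by
    rintro rfl
    exact hplead (hlead.trans (congrArg PartLabel.lead hu.symm))
  refine ⟨w, ⟨⟨hpart.trans hu, hwl, by rw [show (D w).par = ids u from hpu, hids u]⟩, hxp⟩, ?_⟩
  rintro w' ⟨⟨hw', hwl', rfl⟩, hxw'⟩
  obtain ⟨hpart', heq, hadj, -⟩ := hpar w' hw' hwl'
  have hlead' : ids w' ≠ (D (vertex (D w').par)).part.lead := fun h' =>
    hwl' (hids.injective (h'.trans (hu ▸ hlead.symm)))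
  have := huniq _ ⟨⟨mem_recordView.2 ⟨w', ⟨hadj.symm, Set.mem_univ _⟩, rfl⟩, hpart'.symm, hlead',
    heq.symm⟩, hxw'⟩
  exact hids.injective (congrArg Prod.fst this)

theorem treeOfParts_of_localCheck (hids : Function.LeftInverse vertex ids)
    (h : ∀ v, LocalCheck A (ids v) (D v) (recordView G Set.univ ids D v)) :
    TreeOfParts G (fun v => (D v).part) (fun L => vertex L.root) PartLabel.rank where
  rank_root_lt u hu := by
    obtain ⟨-, -, -, -, -, hrank⟩ :=
      exists_lead hids (fun v hv => (h v).numbering (hv ▸ hu)) rfl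
    exact hrank
  of_adj u w huw := by
    rcases forall_mem_recordView.1 (h u).edge w huw (Set.mem_univ w) with
      ⟨hrank, hroot⟩ | ⟨hrank, hroot | hpart⟩
    · exact Or.inl ⟨hrank, hroot ▸ hids u⟩
    · exact Or.inr ⟨hrank, Or.inl (hroot ▸ hids w)⟩
    · exact Or.inr ⟨hrank, Or.inr hpart⟩

theorem accepts_block (hids : Function.LeftInverse vertex ids)
    (h : ∀ v, LocalCheck A (ids v) (D v) (recordView G Set.univ ids D v)) (hL : L.rank ≠ 0)
    (hl : (D l).part = L) (hr : ids r = L.root) (hlr : G.Adj l r)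
    [Fintype ↥(insert r {v | (D v).part = L})] :
    Accepts A (G.induce (insert r {v | (D v).part = L})) (fun x => (entry L (ids x, D x)).1)
      (fun x => (entry L (ids x, D x)).2) := by
  have mem_block (x : V) : x ∈ insert r {v | (D v).part = L} ↔
      x ∈ Set.univ ∧ InBlock L (ids x, D x) := by
    simp only [Set.mem_insert_iff, Set.mem_ofPred_eq, Set.mem_univ, true_and, InBlock, ← hr,
      hids.injective.eq_iff]
  rintro ⟨v, hv⟩
  rw [neighborView_induce_entry mem_block]
  obtain ⟨p, hp, rfl⟩ : ∃ p, (p = (ids v, D v) ∨ p ∈ recordView G Set.univ ids D v) ∧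
      p.2.part = L := by
    rcases hv with rfl | hv
    · exact ⟨_, Or.inr (mem_recordView.2 ⟨l, ⟨hlr.symm, Set.mem_univ l⟩, rfl⟩), hl⟩
    · exact ⟨_, Or.inl rfl, hv⟩
  exact (h v).simulate p hp hL ((mem_block v).1 hv).2

variable {W : Type*} {H : SimpleGraph W} {k : ℕ}

theorem minorFree_block (hk : 1 ≤ k)
    (hA : ∀ (V : Type) [Fintype V] (G : SimpleGraph V), G.Connected → ∀ ids : V → ℕ,
      ValidIds k ids → ∀ c, Accepts A G ids c → MinorFree H G)
    (hids : Function.LeftInverse vertex ids)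
    (h : ∀ v, LocalCheck A (ids v) (D v) (recordView G Set.univ ids D v))
    (hu : (D u).part.rank ≠ 0) :
    MinorFree H (G.induce (insert (vertex (D u).part.root) {v | (D v).part = (D u).part})) := by
  classical
  have hnum (v : V) (hv : (D v).part = (D u).part) := (h v).numbering (hv ▸ hu)
  obtain ⟨l, hl, hlead, hadj, hroot, hrank⟩ := exists_lead hids hnum rfl
  obtain ⟨N, hN⟩ := exists_intervalNumbering hids hnum hl hlead
  have root_notMem : vertex (D u).part.root ∉ {v | (D v).part = (D u).part} := fun hr =>
    hrank.ne (congrArg PartLabel.rank hr)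
  have connected_block :=
    induce_union_connected (induce_pair_connected_of_adj hadj.symm).preconnected
      N.connected.preconnected ⟨l, Set.mem_insert_of_mem _ rfl, hl⟩
  rw [Set.insert_union, Set.singleton_union, Set.insert_eq_of_mem N.root_mem] at connected_block
  have entry_fst (x : V) :
      (entry (D u).part (ids x, D x)).1 = N.blockIds (vertex (D u).part.root) x := by
    grind [entry, IntervalNumbering.blockIds, hids x]
  have hacc := accepts_block hids h hu hl hroot hadj
  simp only [entry_fst] at hacc
  exact hA _ _ connected_block _ (N.validIds_blockIds root_notMem hk) _ hacc

theorem minorFree_of_localCheck [Nontrivial W] (hk : 1 ≤ k) (hH : TwoConnected H)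
    (hA : ∀ (V : Type) [Fintype V] (G : SimpleGraph V), G.Connected → ∀ ids : V → ℕ,
      ValidIds k ids → ∀ c, Accepts A G ids c → MinorFree H G)
    (hids : Function.LeftInverse vertex ids)
    (h : ∀ v, LocalCheck A (ids v) (D v) (recordView G Set.univ ids D v)) : MinorFree H G :=
  (treeOfParts_of_localCheck hids h).minorFree hH fun _ hu hmin =>
    minorFree_block hk hA hids h hu (isMinor_induce_iff.2 hmin)

end Soundness

section Completeness

theorem NumberingCheck.mono {i : ℕ} {R : VertexRecord} {N M : Finset (ℕ × VertexRecord)}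
    (h : NumberingCheck i R N) (hNM : N ⊆ M) (hM : ∀ p ∈ M, p.2.part = R.part → p ∈ N) :
    NumberingCheck i R M where
  lead hi := (h.lead hi).imp_right fun ⟨p, hp, hroot⟩ => ⟨p, hNM hp, hroot⟩
  parent hi := (h.parent hi).imp fun _ hp => hp.imp_left (@hNM _)
  lo_lt_hi := h.lo_lt_hi
  children x hx := by
    refine (existsUnique_congr fun p => ?_).1 (h.children x hx)
    exact and_congr_left' ⟨fun hp => ⟨hNM hp.1, hp.2⟩, fun hp => ⟨hM p hp.1 hp.2.1, hp.2⟩⟩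

theorem blockView_congr {L : PartLabel} {N M : Finset (ℕ × VertexRecord)}
    (hNM : N ⊆ M) (hM : ∀ p ∈ M, InBlock L p → p ∈ N) : blockView L M = blockView L N := by
  classical
  rw [blockView, blockView]
  congr 1
  ext p
  simp only [Finset.mem_filter]
  exact ⟨fun hp => ⟨hM p hp.1 hp.2, hp.2⟩, fun hp => ⟨hNM hp.1, hp.2⟩⟩

/-- The vertex may acquire further neighbors in a new block that hangs on it. -/
theorem LocalCheck.mono {A : Verifier} {i : ℕ} {R : VertexRecord}
    {N M : Finset (ℕ × VertexRecord)} (h : LocalCheck A i R N) (hNM : N ⊆ M)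
    (hM : ∀ p ∈ M, p ∈ N ∨ p.2.part.rank ≠ 0 ∧ p.2.part.root = i ∧
      (∀ q, q = (i, R) ∨ q ∈ N → q.2.part.rank ≠ 0 → ¬ InBlock q.2.part p) ∧
      A (entry p.2.part (i, R)) (blockView p.2.part M) = true) : LocalCheck A i R M where
  edge p hp := by
    rcases hM p hp with hpN | ⟨hrank, hroot, -⟩
    · exact h.edge p hpN
    · exact Or.inl ⟨hrank, hroot⟩
  numbering hR := by
    refine (h.numbering hR).mono hNM fun p hp hpart => (hM p hp).resolve_right ?_
    rintro ⟨-, -, hnot, -⟩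
    exact hnot _ (Or.inl rfl) hR (Or.inr hpart)
  simulate q hq hrank hblock := by
    by_cases hqN : q = (i, R) ∨ q ∈ N
    · rw [blockView_congr hNM fun p hp hpL => (hM p hp).resolve_right fun hnew =>
        hnew.2.2.1 q hqN hrank hpL]
      exact h.simulate q hqN hrank hblock
    · rw [not_or] at hqN
      obtain ⟨-, -, -, hsim⟩ := (hM q (hq.resolve_left hqN.1)).resolve_left hqN.2
      exact hsim

variable {V : Type} {G : SimpleGraph V} {A : Verifier} {ids : V → ℕ}
  {D : V → VertexRecord} {S P : Set V} {l ρ : V} {L : PartLabel} {c : V → Certificate}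
  {k b : ℕ}

/-- The records `D` of the vertices of `P` describe the numbering `N` and the certificates `c`,
under the label `L` of the block `insert ρ P`. -/
structure IsBlockLabelling (N : IntervalNumbering G P l 2) (S : Set V) (ρ : V) (ids : V → ℕ)
    (c : V → Certificate) (L : PartLabel) (D : V → VertexRecord) : Prop where
  lead : L.lead = ids l
  root : L.root = ids ρ
  rootCert : L.rootCert = c ρ
  part_iff : ∀ v ∈ S, (D v).part = L ↔ v ∈ P
  par : ∀ v ∈ P, (D v).par = ids (N.par v)
  lo : ∀ v ∈ P, (D v).lo = N.lo v
  hi : ∀ v ∈ P, (D v).hi = N.hi v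
  cert : ∀ v ∈ P, (D v).cert = c v

open Classical in
/-- The records that extend the records `D` to a new block `insert ρ P` with label `L`. -/
noncomputable def attachBlock (N : IntervalNumbering G P l 2) (ids : V → ℕ) (c : V → Certificate)
    (L : PartLabel) (D : V → VertexRecord) (v : V) : VertexRecord :=
  if v ∈ P then ⟨L, ids (N.par v), N.lo v, N.hi v, c v⟩ else D v

theorem attachBlock_of_notMem {N : IntervalNumbering G P l 2} {v : V} (hv : v ∉ P) :
    attachBlock N ids c L D v = D v :=
  if_neg hv

theorem isBlockLabelling_attachBlock (N : IntervalNumbering G P l 2) (ids : V → ℕ)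
    (c : V → Certificate) {rank : ℕ} (hrank : ∀ v ∈ S \ P, (D v).part.rank < rank) :
    IsBlockLabelling N S ρ ids c ⟨rank, ids l, ids ρ, c ρ⟩
      (attachBlock N ids c ⟨rank, ids l, ids ρ, c ρ⟩ D) := by
  constructor <;> grind [attachBlock]

theorem IntervalNumbering.exists_accepts [Finite V] (N : IntervalNumbering G P l 2) (hk : 1 ≤ k)
    (hA : ∀ (B : Set V) [Fintype ↥B], TwoConnected (G.induce B) → ∀ i : ↥B → ℕ, ValidIds k i →
      ∃ c : ↥B → Certificate, (∀ x, (c x).length ≤ b) ∧ Accepts A (G.induce B) i c)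
    (hρ : ρ ∉ P) (hP : TwoConnected (G.induce (insert ρ P))) [Fintype ↥(insert ρ P)] :
    ∃ c : V → Certificate, (∀ v, (c v).length ≤ b) ∧
      Accepts A (G.induce (insert ρ P)) (fun x => N.blockIds ρ x) (fun x => c x) := by
  classical
  obtain ⟨c, hlen, hacc⟩ := hA _ hP _ (N.validIds_blockIds hρ hk)
  refine ⟨fun v => if hv : v ∈ insert ρ P then c ⟨v, hv⟩ else [], fun v => ?_, ?_⟩
  · dsimp only
    split
    · exact hlen _
    · exact Nat.zero_le b
  · convert hacc with x
    exact dif_pos x.2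

variable [Fintype V]

namespace IsBlockLabelling

variable {N : IntervalNumbering G P l 2}

theorem simulate (h : IsBlockLabelling N S ρ ids c L D) (hids : Function.Injective ids)
    (hP : IsLeafBlock G S P ρ) [Fintype ↥(insert ρ P)]
    (hacc : Accepts A (G.induce (insert ρ P)) (fun x => N.blockIds ρ x) (fun x => c x))
    {v : V} (hv : v ∈ insert ρ P) :
    A (entry L (ids v, D v)) (blockView L (recordView G S ids D v)) = true := by
  have mem_block (x : V) : x ∈ insert ρ P ↔ x ∈ S ∧ InBlock L (ids x, D x) := by
    have hρ := hP.root_mem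
    have hsub := @hP.subset x
    grind [InBlock, h.root, h.part_iff, hids.eq_iff]
  have entry_eq (x : V) (hx : x ∈ insert ρ P) : entry L (ids x, D x) = (N.blockIds ρ x, c x) := by
    rcases hx with rfl | hx
    · rw [entry, if_pos h.root.symm, h.rootCert, N.blockIds_root]
    · have hxρ : x ≠ ρ := ne_of_mem_of_not_mem hx hP.root_mem.2
      rw [entry, if_neg (h.root ▸ hids.ne hxρ), h.lo x hx, h.cert x hx, N.blockIds_of_ne hxρ]
  rw [← neighborView_induce_entry mem_block ⟨v, hv⟩]
  simpa only [entry_eq, Subtype.coe_prop, hv] using hacc ⟨v, hv⟩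

theorem numberingCheck (h : IsBlockLabelling N S ρ ids c L D) (hids : Function.Injective ids)
    (hP : IsLeafBlock G S P ρ) (hlρ : G.Adj l ρ) (hrank : (D ρ).part.rank < L.rank) {v : V}
    (hv : v ∈ P) : NumberingCheck (ids v) (D v) (recordView G S ids D v) := by
  have hpart (w : V) (hw : w ∈ P) : (D w).part = L := (h.part_iff w (hP.subset hw)).2 hw
  refine ⟨fun hlead => ?_, fun hlead => ?_, ?_, fun x hx => ?_⟩
  · obtain rfl : v = l := hids (by rw [hlead, hpart v hv, h.lead])
    refine ⟨(h.lo v hv).trans N.lo_root, _,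
      mem_recordView.2 ⟨ρ, ⟨hlρ, hP.root_mem.1⟩, rfl⟩, ?_⟩
    rw [hpart v hv]
    exact ⟨h.root.symm, hrank⟩
  · have hvl : v ≠ l := fun hvl => hlead (by rw [hpart v hv, h.lead, hvl])
    have hpar := N.par_mem v hv hvl
    refine ⟨_, mem_recordView.2 ⟨N.par v, ⟨N.adj_par v hv hvl, hP.subset hpar⟩, rfl⟩, ?_⟩
    simp only [hpart _ hpar, hpart v hv, h.par v hv, h.lo _ hpar, h.lo v hv, h.hi v hv,
      h.hi _ hpar, true_and]
    exact ⟨N.lo_par_lt v hv hvl, N.hi_le_hi_par v hv hvl⟩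
  · rw [h.lo v hv, h.hi v hv]
    exact N.lo_lt_hi v hv
  · rw [h.lo v hv, h.hi v hv] at hx
    obtain ⟨w, ⟨⟨hw, hwl, rfl⟩, hxw⟩, huniq⟩ := N.existsUnique_child v hv x hx
    refine ⟨(ids w, D w), ⟨⟨mem_recordView.2
      ⟨w, ⟨(N.adj_par w hw hwl).symm, hP.subset hw⟩, rfl⟩, ?_⟩, ?_⟩, ?_⟩
    · rw [hpart w hw, hpart _ hv, h.lead]
      exact ⟨rfl, hids.ne hwl, h.par w hw⟩
    · rwa [h.lo w hw, h.hi w hw]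
    · rintro p ⟨⟨hp, hp_part, hp_lead, hp_par⟩, hxp⟩
      obtain ⟨w', ⟨-, hw'S⟩, rfl⟩ := mem_recordView.1 hp
      have hw' : w' ∈ P := (h.part_iff w' hw'S).1 (hp_part.trans (hpart _ hv))
      rw [hpart _ hv, h.lead] at hp_lead
      rw [h.lo w' hw', h.hi w' hw'] at hxp
      rw [huniq w' ⟨⟨hw', fun heq => hp_lead (congrArg ids heq),
        hids ((h.par w' hw').symm.trans hp_par)⟩, hxp⟩]

theorem localCheck (h : IsBlockLabelling N S ρ ids c L D) (hids : Function.Injective ids)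
    (hP : IsLeafBlock G S P ρ) (hlρ : G.Adj l ρ) (hrank : (D ρ).part.rank < L.rank)
    (hroot : (D ρ).part.rank ≠ 0 → ∃ q ∈ S \ P, ids q = (D ρ).part.root)
    (hsim : ∀ v ∈ insert ρ P,
      A (entry L (ids v, D v)) (blockView L (recordView G S ids D v)) = true) {v : V}
    (hv : v ∈ P) : LocalCheck A (ids v) (D v) (recordView G S ids D v) := by
  have hpart (w : V) (hw : w ∈ P) : (D w).part = L := (h.part_iff w (hP.subset hw)).2 hw
  refine ⟨forall_mem_recordView.2 fun w hvw hw => Or.inr ?_,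
    fun _ => h.numberingCheck hids hP hlρ hrank hv, fun p hp hp0 hblock => ?_⟩
  · rw [hpart v hv]
    refine ⟨hrank.ne_bot, (hP.mem_insert_of_adj hv hw hvw).imp (fun hwρ => ?_) (hpart w)⟩
    rw [hwρ, h.root]
  · suffices p.2.part = L from this ▸ hsim v (Set.mem_insert_of_mem ρ hv)
    rcases hp with rfl | hp
    · exact hpart v hv
    obtain ⟨w, ⟨hvw, hw⟩, rfl⟩ := mem_recordView.1 hp
    rcases hP.mem_insert_of_adj hv hw hvw with rfl | hwP
    · rcases hblock with hroot_eq | hpart_eq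
      · obtain ⟨q, hq, hqroot⟩ := hroot hp0
        exact absurd (hids (hqroot.trans hroot_eq.symm) ▸ hv) hq.2
      · exact hpart_eq.symm.trans (hpart v hv)
    · exact hpart w hwP

theorem localCheck_of_notMem (h : IsBlockLabelling N S ρ ids c L D)
    (hids : Function.Injective ids) (hP : IsLeafBlock G S P ρ)
    (hrank : ∀ w ∈ S \ P, (D w).part.rank < L.rank)
    (hroot : ∀ w ∈ S \ P, (D w).part.rank ≠ 0 → ∃ q ∈ S \ P, ids q = (D w).part.root)
    (hsim : ∀ v ∈ insert ρ P,
      A (entry L (ids v, D v)) (blockView L (recordView G S ids D v)) = true) {v : V}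
    (hv : v ∈ S \ P) (hcheck : LocalCheck A (ids v) (D v) (recordView G (S \ P) ids D v)) :
    LocalCheck A (ids v) (D v) (recordView G S ids D v) := by
  have notMem_block (u : V) (hu : u ∈ P) (w : V) (hw : w ∈ S \ P) (hw0 : (D w).part.rank ≠ 0) :
      ¬ InBlock (D w).part (ids u, D u) := by
    rintro (heq | heq)
    · obtain ⟨q, hq, hq_root⟩ := hroot w hw hw0
      exact hq.2 (hids (hq_root.trans heq.symm) ▸ hu)
    · rw [(h.part_iff u (hP.subset hu)).2 hu] at heq
      exact (hrank w hw).ne (congrArg PartLabel.rank heq.symm)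
  refine hcheck.mono (fun p hp => ?_) (forall_mem_recordView.2 fun u hvu hu => ?_)
  · obtain ⟨u, ⟨hvu, hu⟩, rfl⟩ := mem_recordView.1 hp
    exact mem_recordView.2 ⟨u, ⟨hvu, hu.1⟩, rfl⟩
  by_cases huP : u ∈ P
  · obtain rfl : v = ρ := (hP.mem_insert_of_adj huP hv.1 hvu.symm).resolve_right hv.2
    have hpart : (D u).part = L := (h.part_iff u hu).2 huP
    refine Or.inr ⟨?_, ?_, ?_, ?_⟩
    · simpa only [hpart] using Nat.ne_zero_of_lt (hrank v hv)
    · simpa only [hpart] using h.root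
    · rintro q (rfl | hq)
      · exact notMem_block u huP v hv
      · obtain ⟨w, ⟨-, hw⟩, rfl⟩ := mem_recordView.1 hq
        exact notMem_block u huP w hw
    · simpa only [hpart] using hsim v (Set.mem_insert v P)
  · exact Or.inl (mem_recordView.2 ⟨u, ⟨hvu, hu, huP⟩, rfl⟩)

end IsBlockLabelling

/-- The invariant of the construction of the records, leaf block by leaf block: the records on `S`
pass the local checks in `G.induce S`, their numbers are at most `m` and their certificates have
length at most `b`. The vertex `r` belongs to no part. -/
structure ValidRecords (A : Verifier) (G : SimpleGraph V) (ids : V → ℕ) (m b : ℕ) (r : V)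
    (S : Set V) (D : V → VertexRecord) : Prop where
  eq_default : D r = default
  rank_lt : ∀ v ∈ S, (D v).part.rank < S.ncard
  exists_root : ∀ v ∈ S, (D v).part.rank ≠ 0 → ∃ q ∈ S, ids q = (D v).part.root
  bounded : ∀ v ∈ S, (D v).Bounded m b
  localCheck : ∀ v ∈ S, LocalCheck A (ids v) (D v) (recordView G S ids D v)

namespace ValidRecords

variable {m : ℕ} {r : V}

theorem singleton (A : Verifier) (G : SimpleGraph V) (ids : V → ℕ) (m b : ℕ) (r : V) :
    ValidRecords A G ids m b r {r} fun _ => default where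
  eq_default := rfl
  rank_lt _ _ := by
    rw [Set.ncard_singleton]
    exact Nat.one_pos
  exists_root _ _ h := absurd rfl h
  bounded _ _ := VertexRecord.bounded_default m b
  localCheck := by
    rintro v rfl
    refine ⟨forall_mem_recordView.2 ?_, fun h => absurd rfl h, ?_⟩
    · rintro u hvu rfl
      exact absurd hvu (G.irrefl)
    · rintro p (rfl | hp) hrank -
      · exact absurd rfl hrank
      · obtain ⟨u, -, rfl⟩ := mem_recordView.1 hp
        exact absurd rfl hrank

theorem congr {D' : V → VertexRecord} (h : ValidRecords A G ids m b r S D) (hr : r ∈ S)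
    (hD : Set.EqOn D' D S) : ValidRecords A G ids m b r S D' where
  eq_default := (hD hr).trans h.eq_default
  rank_lt v hv := hD hv ▸ h.rank_lt v hv
  exists_root v hv := hD hv ▸ h.exists_root v hv
  bounded v hv := hD hv ▸ h.bounded v hv
  localCheck v hv := by
    have hview : recordView G S ids D' v = recordView G S ids D v := by
      ext p
      simp only [mem_recordView]
      exact exists_congr fun u => and_congr_right fun hu => by rw [hD hu.2]
    rw [hview, hD hv]
    exact h.localCheck v hv

theorem of_isLeafBlock {N : IntervalNumbering G P l 2}
    (h : ValidRecords A G ids m b r (S \ P) D) (hB : IsBlockLabelling N S ρ ids c L D)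
    (hL : L.rank = (S \ P).ncard) (hids : Function.Injective ids) (hidm : ∀ v, ids v ≤ m)
    (hm : Nat.card V + 1 ≤ m) (hc : ∀ v, (c v).length ≤ b) (hP : IsLeafBlock G S P ρ)
    (hlρ : G.Adj l ρ)
    (hsim : ∀ v ∈ insert ρ P,
      A (entry L (ids v, D v)) (blockView L (recordView G S ids D v)) = true) :
    ValidRecords A G ids m b r S D := by
  have hρ := hP.root_mem
  have hpart (v : V) (hv : v ∈ P) : (D v).part = L := (hB.part_iff v (hP.subset hv)).2 hv
  have hrank (v : V) (hv : v ∈ S \ P) : (D v).part.rank < L.rank := hL ▸ h.rank_lt v hv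
  have hncard : L.rank + P.ncard = S.ncard := by
    rw [hL, Set.ncard_sdiff_add_ncard_of_subset hP.subset]
  have hP0 : 0 < P.ncard := hP.nonempty.ncard_pos
  have hS := Set.ncard_le_card S
  refine ⟨h.eq_default, fun v hv => ?_, fun v hv => ?_, fun v hv => ?_, fun v hv => ?_⟩
  all_goals by_cases hvP : v ∈ P
  · rw [hpart v hvP]
    omega
  · have := hrank v ⟨hv, hvP⟩
    omega
  · exact fun _ => ⟨ρ, hρ.1, hpart v hvP ▸ hB.root.symm⟩
  · exact fun hv0 => (h.exists_root v ⟨hv, hvP⟩ hv0).imp fun q hq => hq.imp_left And.left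
  · have := N.lo_lt_hi v hvP
    have := N.hi_le hvP
    have : 0 < (S \ P).ncard := (Set.nonempty_of_mem hρ).ncard_pos
    constructor
    all_goals simp only [hpart v hvP, hB.lead, hB.root, hB.rootCert, hB.par v hvP, hB.lo v hvP,
      hB.hi v hvP, hB.cert v hvP, hidm, hc]
    all_goals omega
  · exact h.bounded v ⟨hv, hvP⟩
  · exact hB.localCheck hids hP hlρ (hrank ρ hρ) (h.exists_root ρ hρ) hsim hvP
  · exact hB.localCheck_of_notMem hids hP hrank h.exists_root hsim ⟨hv, hvP⟩
      (h.localCheck v ⟨hv, hvP⟩)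

theorem exists_of_isLeafBlock (h : ValidRecords A G ids m b r (S \ P) D)
    (hids : Function.Injective ids) (hidm : ∀ v, ids v ≤ m) (hm : Nat.card V + 1 ≤ m) (hk : 1 ≤ k)
    (hA : ∀ (B : Set V) [Fintype ↥B], TwoConnected (G.induce B) → ∀ i : ↥B → ℕ, ValidIds k i →
      ∃ c : ↥B → Certificate, (∀ x, (c x).length ≤ b) ∧ Accepts A (G.induce B) i c)
    (hP : IsLeafBlock G S P ρ) (hr : r ∈ S \ P) : ∃ D', ValidRecords A G ids m b r S D' := by
  classical
  obtain ⟨l, hl, hlρ⟩ : ∃ l ∈ P, G.Adj l ρ := hP.exists_adj_root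
  obtain ⟨N⟩ := IntervalNumbering.nonempty_of_connected hP.connected_part hl 2
  obtain ⟨c, hc, hacc⟩ := N.exists_accepts hk hA hP.root_mem.2 hP.twoConnected
  have hB := isBlockLabelling_attachBlock (ρ := ρ) N ids c h.rank_lt
  refine ⟨attachBlock N ids c ⟨(S \ P).ncard, ids l, ids ρ, c ρ⟩ D,
    of_isLeafBlock (h.congr hr fun v hv => attachBlock_of_notMem hv.2) hB rfl hids hidm hm hc hP hlρ
      fun v hv => hB.simulate hids hP hacc hv⟩

theorem exists_univ (hG : G.Connected) (hids : Function.Injective ids) (hidm : ∀ v, ids v ≤ m)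
    (hm : Nat.card V + 1 ≤ m) (hk : 1 ≤ k)
    (hA : ∀ (B : Set V) [Fintype ↥B], TwoConnected (G.induce B) → ∀ i : ↥B → ℕ, ValidIds k i →
      ∃ c : ↥B → Certificate, (∀ x, (c x).length ≤ b) ∧ Accepts A (G.induce B) i c) (r : V) :
    ∃ D, ValidRecords A G ids m b r Set.univ D := by
  refine leafBlock_induction (G := G) (r := r)
    (p := fun S => ∃ D, ValidRecords A G ids m b r S D) ⟨_, singleton A G ids m b r⟩
    (fun S P ρ hP hr ⟨D, hD⟩ => hD.exists_of_isLeafBlock hids hidm hm hk hA hP hr) ?_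
    (Set.mem_univ r)
  exact (induceUnivIso G).connected_iff.2 hG

end ValidRecords

end Completeness

section Reduction

variable {W : Type*} {H : SimpleGraph W} {V : Type} [Fintype V] {G : SimpleGraph V}

theorem ValidRecords.length_encode_le {A : Verifier} {ids : V → ℕ} {D : V → VertexRecord}
    {k b : ℕ} {r : V}
    (h : ValidRecords A G ids (Fintype.card V ^ k + 1) b r Set.univ D) (hk : k ≠ 0) (v : V) :
    (D v).encode.length ≤ (24 * k + 19) * (b + Nat.log 2 (Fintype.card V)) := by
  rcases eq_or_ne v r with rfl | hv
  · rw [h.eq_default, VertexRecord.encode_default]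
    exact Nat.zero_le _
  · have two_le_card : 2 ≤ Fintype.card V := Fintype.one_lt_card_iff.2 ⟨v, r, hv⟩
    exact (h.bounded v (Set.mem_univ v)).length_encode_le_log hk two_le_card

open Classical in
/-- The verifier that reads the certificates as records and performs the test `LocalCheck A`. -/
noncomputable def recordVerifier (A : Verifier) : Verifier := fun p N =>
  decide (LocalCheck A p.1 (VertexRecord.decode p.2)
    (N.image fun q => (q.1, VertexRecord.decode q.2)))

theorem accepts_recordVerifier {A : Verifier} {ids : V → ℕ} {c : V → Certificate} :
    Accepts (recordVerifier A) G ids c ↔ ∀ v, LocalCheck A (ids v) (VertexRecord.decode (c v))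
      (recordView G Set.univ ids (fun u => VertexRecord.decode (c u)) v) := by
  simp only [Accepts, recordVerifier, decide_eq_true_eq, recordView_univ]

theorem exists_accepts_recordVerifier {A : Verifier} {ids : V → ℕ} {k b : ℕ} (hk : 1 ≤ k)
    (hG : G.Connected) (hids : ValidIds k ids)
    (hA : ∀ (B : Set V) [Fintype ↥B], TwoConnected (G.induce B) → ∀ i : ↥B → ℕ, ValidIds k i →
      ∃ c : ↥B → Certificate, (∀ x, (c x).length ≤ b) ∧ Accepts A (G.induce B) i c) :
    ∃ c : V → Certificate,
      (∀ v, (c v).length ≤ (24 * k + 19) * (b + Nat.log 2 (Fintype.card V))) ∧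
      Accepts (recordVerifier A) G ids c := by
  obtain ⟨r⟩ := hG.nonempty
  have hk0 : k ≠ 0 := Nat.one_le_iff_ne_zero.1 hk
  have card_le : Nat.card V + 1 ≤ Fintype.card V ^ k + 1 := by
    rw [Nat.card_eq_fintype_card]
    exact Nat.succ_le_succ (Nat.le_self_pow hk0 _)
  obtain ⟨D, hD⟩ := ValidRecords.exists_univ hG hids.1
    (fun v => (hids.2 v).2.trans (Nat.le_succ _)) card_le hk hA r
  refine ⟨fun v => (D v).encode, hD.length_encode_le hk0, accepts_recordVerifier.2 fun v => ?_⟩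
  simp only [VertexRecord.decode_encode]
  exact hD.localCheck v (Set.mem_univ v)

theorem minorFree_of_accepts_recordVerifier [Nontrivial W] {A : Verifier} {ids : V → ℕ}
    {c : V → Certificate} {k : ℕ} (hk : 1 ≤ k) (hH : TwoConnected H) (hG : G.Connected)
    (hA : ∀ (V : Type) [Fintype V] (G : SimpleGraph V), G.Connected → ∀ ids : V → ℕ,
      ValidIds k ids → ∀ c, Accepts A G ids c → MinorFree H G)
    (hids : Function.Injective ids) (h : Accepts (recordVerifier A) G ids c) : MinorFree H G :=
  have := hG.nonempty
  minorFree_of_localCheck hk hH hA (Function.leftInverse_invFun hids) (accepts_recordVerifier.1 h)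

end Reduction

theorem mainTheorem5_general (k : ℕ) (hk : 1 ≤ k) {W : Type*} (H : SimpleGraph W)
    (hH : TwoConnected H) {f : ℕ → ℕ} (hf : Monotone f)
    (h : CertifiableWith k f (fun {_} G => TwoConnected G ∧ MinorFree H G)) :
    CertifiableWith k (fun n => (24 * k + 19) * (f n + Nat.log 2 n))
      (fun {_} G => MinorFree H G) := by
  rcases subsingleton_or_nontrivial W
  · refine ⟨fun _ _ => false, fun V _ G hG ids _ =>
      ⟨fun hmf => absurd hmf (not_minorFree_of_subsingleton hG), fun _ c hacc => ?_⟩⟩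
    exact Bool.false_ne_true (hacc hG.nonempty.some)
  obtain ⟨A, hA⟩ := h
  refine ⟨recordVerifier A, fun V _ G hG ids hids => ⟨fun hmf => ?_, fun hmf c hacc => hmf ?_⟩⟩
  · refine exists_accepts_recordVerifier hk hG hids fun B _ hB i hi => ?_
    obtain ⟨c, hc, hacc⟩ := (hA ↥B _ hB.1 i hi).1 ⟨hB, hmf.induce B⟩
    exact ⟨c, fun x => (hc x).trans (hf (Fintype.card_subtype_le (· ∈ B))), hacc⟩
  · refine minorFree_of_accepts_recordVerifier hk hH hG (fun V' _ G' hG' i hi c' hacc' => ?_)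
      hids.1 hacc
    exact (not_imp_comm.1 (hA V' G' hG' i hi).2 fun hrej => hrej c' hacc').2

end LocalCert

theorem mainTheorem5 (k : ℕ) (hk : 1 ≤ k) {W : Type*} [Finite W] (H : SimpleGraph W)
    (hH : LocalCert.TwoConnected H) :
    ∃ C : ℕ, ∀ f : ℕ → ℕ, Monotone f →
      LocalCert.CertifiableWith k f
        (fun {_} G => LocalCert.TwoConnected G ∧ LocalCert.MinorFree H G) →
      LocalCert.CertifiableWith k (fun n => C * (f n + Nat.log 2 n))
        (fun {_} G => LocalCert.MinorFree H G) :=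
  ⟨24 * k + 19, fun _ hf => LocalCert.mainTheorem5_general k hk H hH hf⟩
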